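/- Let $(X_0,X_1)$ be a compatible couple of (real or complex) quasi-Banach spaces, i.e. both are continuously embedded in a Hausdorff topological vector space, and for $f\in X_0+X_1$, $t>0$ let $$K(t,f)=K(t,f;X_0,X_1)=\inf\{\|f_0\|_{X_0}+t\|f_1\|_{X_1}: f=f_0+f_1,\ f_j\in X_j\}.$$ Rearrangement invariant (r.i.) spaces are r.i. Banach function spaces on $(0,\infty)$ with Lebesgue measure that have the Fatou property. For an r.i. space $E$, $\widetilde E$ denotes the corresponding space for the measure $dt/t$, that is, $\|f\|_{\widetilde E}=\|f^{*}\|_E$ where $f^{*}$ is the non-increasing rearrangement of $f$ with respect to $dt/t$; and $\|f\|_{\widetilde E(I)}=\|f\chi_I\|_{\widetilde E}$ for an interval $I\subset(0,\infty)$. A measurable function $b:(0,\infty)\to(0,\infty)$ is slowly varying, $b\in SV$, if for each $\varepsilon>0$ the function $t^{\varepsilon}b(t)$ is equivalent to a non-decreasing function and $t^{-\varepsilon}b(t)$ is equivalent to a non-increasing function on $(0,\infty)$, where two functions are equivalent if each is at most a constant times the other. For $0<\theta<1$, $a,b\in SV$ and r.i. spaces $E,F$ let $\overline X^{\mathcal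 R}_{\theta,b,E,a,F}$ be the space of all $f\in X_0+X_1$ with $$\|f\|_{\mathcal R;\theta,b,E,a,F}=\Big\|b(t)\,\|s^{-\theta}a(s)K(s,f)\|_{\widetilde F(t,\infty)}\Big\|_{\widetilde E}<\infty .$$ **Theorem.** Let $0<\theta_0<\theta_1<1$, let $E_0,E_1,F_0,F_1$ be r.i. spaces and let $a_0,a_1,b_0,b_1\in SV$ be such that $\|b_0\|_{\widetilde E_0(0,1)}<\infty$ and $\|b_1\|_{\widetilde E_1(0,1)}<\infty$. Put $Y_j=\overline X^{\mathcal R}_{\theta_j,b_j,E_j,a_j,F_j}$, $j=0,1$, and $$\rho(u)=u^{\theta_1-\theta_0}\,\frac{a_0(u)\|b_0\|_{\widetilde E_0(0,u)}}{a_1(u)\|b_1\|_{\widetilde E_1(0,u)}},\qquad u>0.$$ Then for every $f\in Y_0+Y_1$ and every $u>0$, $$\begin{aligned}K(\rho(u),f;Y_0,Y_1)\sim{}&\Big\|b_0(t)\,\|s^{-\theta_0}a_0(s)K(s,f)\|_{\widetilde F_0(t,u)}\Big\|_{\widetilde E_0(0,u)}\\&+\rho(u)\,\|b_1\|_{\widetilde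 E_1(0,u)}\,\|t^{-\theta_1}a_1(t)K(t,f)\|_{\widetilde F_1(u,\infty)}\\&+\rho(u)\,\Big\|b_1(t)\,\|s^{-\theta_1}a_1(s)K(s,f)\|_{\widetilde F_1(t,\infty)}\Big\|_{\widetilde E_1(u,\infty)},\end{aligned}$$ where $\sim$ means that each side is at most a constant $C>0$ times the other, with $C$ independent of $f$ and $u$. -/

import Mathlib

open MeasureTheory Set Filter Topology
open scoped ENNReal NNReal

noncomputable section

/-- A Banach function space over `(α, μ)` in the sense of Luxemburg, given by its function norm on
the `[0, ∞]`-valued measurable functions; the space consists of the `f` with `norm |f| < ∞`. The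
Fatou property is part of the definition. -/
structure BanachFunctionSpace {α : Type*} [MeasurableSpace α] (μ : Measure α) where
  /-- the function norm -/
  norm : (α → ℝ≥0∞) → ℝ≥0∞
  norm_eq_zero_iff : ∀ f, AEMeasurable f μ → (norm f = 0 ↔ f =ᵐ[μ] 0)
  norm_const_mul : ∀ (c : ℝ≥0) (f), AEMeasurable f μ → norm (fun x => c * f x) = c * norm f
  norm_add_le : ∀ f g, AEMeasurable f μ → AEMeasurable g μ →
    norm (fun x => f x + g x) ≤ norm f + norm g
  norm_mono : ∀ f g, AEMeasurable f μ → AEMeasurable g μ → f ≤ᵐ[μ] g → norm f ≤ norm g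
  fatou : ∀ f : ℕ → α → ℝ≥0∞, (∀ n, AEMeasurable (f n) μ) → (∀ n, f n ≤ᵐ[μ] f (n + 1)) →
    norm (fun x => ⨆ n, f n x) = ⨆ n, norm (f n)
  norm_indicator_lt_top : ∀ S, MeasurableSet S → μ S < ∞ → norm (S.indicator fun _ => 1) < ∞
  lintegral_le : ∀ S, MeasurableSet S → μ S < ∞ →
    ∃ C : ℝ≥0, ∀ f, AEMeasurable f μ → ∫⁻ x in S, f x ∂μ ≤ C * norm f

/-- The non-increasing rearrangement `f*(t) = inf {l : μ {f > l} ≤ t}`, `t > 0`, of a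
`[0, ∞]`-valued function with respect to the measure `μ`. -/
def decreasingRearrangement {α : Type*} [MeasurableSpace α] (μ : Measure α) (f : α → ℝ≥0∞)
    (t : ℝ) : ℝ≥0∞ :=
  sInf {l : ℝ≥0∞ | μ {x | l < f x} ≤ ENNReal.ofReal t}

/-- Lebesgue measure on `(0, ∞)`. -/
def lebesguePos : Measure ℝ := volume.restrict (Ioi 0)

/-- The homogeneous measure `dt / t` on `(0, ∞)`. -/
def homogeneousPos : Measure ℝ := lebesguePos.withDensity fun t => ENNReal.ofReal t⁻¹

/-- A rearrangement invariant Banach function space on `(0, ∞)` with Lebesgue measure. -/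
structure RISpace extends BanachFunctionSpace lebesguePos where
  norm_le_of_rearrangement_le : ∀ f g, AEMeasurable f lebesguePos → AEMeasurable g lebesguePos →
    (∀ t, 0 < t → decreasingRearrangement lebesguePos f t ≤ decreasingRearrangement lebesguePos g t) →
    norm f ≤ norm g

/-- The norm of the space `Ẽ` that corresponds to `E` for the measure `dt / t`: the norm in `E` of
the rearrangement of `f` with respect to `dt / t`. Since `((0, ∞), dt)` and `((0, ∞), dt / t)` are
isomorphic measure spaces, this is also the norm that results when `E` is obtained from the couple
`(L₁, L_∞)` by an interpolation functor and the functor is applied to `(L₁(dt / t), L_∞)`. -/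
def RISpace.tildeNorm (E : RISpace) (f : ℝ → ℝ≥0∞) : ℝ≥0∞ :=
  E.norm (decreasingRearrangement homogeneousPos f)

/-- The norm of `Ẽ(S)` for a part `S` of `(0, ∞)`: the function is cut off outside `S`. -/
def RISpace.tildeNormOn (E : RISpace) (S : Set ℝ) (f : ℝ → ℝ≥0∞) : ℝ≥0∞ :=
  E.tildeNorm (S.indicator f)

/-- `f ∼ g` on `(0, ∞)`. -/
def EquivalentOnPos (f g : ℝ → ℝ) : Prop :=
  ∃ C : ℝ, 0 < C ∧ ∀ t, 0 < t → f t ≤ C * g t ∧ g t ≤ C * f t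

/-- Slowly varying functions on `(0, ∞)`; the values of `b` outside `(0, ∞)` play no role. -/
structure SlowlyVarying (b : ℝ → ℝ) : Prop where
  pos : ∀ t, 0 < t → 0 < b t
  aemeasurable : AEMeasurable b lebesguePos
  equiv_monotone : ∀ ε : ℝ, 0 < ε →
    ∃ g : ℝ → ℝ, MonotoneOn g (Ioi 0) ∧ EquivalentOnPos (fun t => t ^ ε * b t) g
  equiv_antitone : ∀ ε : ℝ, 0 < ε →
    ∃ g : ℝ → ℝ, AntitoneOn g (Ioi 0) ∧ EquivalentOnPos (fun t => t ^ (-ε) * b t) g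

/-- A quasi-Banach space continuously embedded in the topological vector space `A`. It is given by
its quasi-norm, extended to `A` by the value `∞` outside the space, so that the space is
`{x | norm x < ∞}`. -/
structure EmbeddedQuasiBanach (𝕜 A : Type*) [RCLike 𝕜] [AddCommGroup A] [Module 𝕜 A]
    [TopologicalSpace A] where
  /-- the quasi-norm, equal to `∞` outside the space -/
  norm : A → ℝ≥0∞
  norm_eq_zero_iff : ∀ x, norm x = 0 ↔ x = 0
  norm_smul : ∀ (c : 𝕜) (x : A), norm (c • x) = ‖c‖ₑ * norm x
  norm_add_le : ∃ κ : ℝ≥0, ∀ x y, norm (x + y) ≤ κ * (norm x + norm y)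
  complete : ∀ v : ℕ → A, (∀ n, norm (v n) < ∞) →
    (∀ ε : ℝ≥0∞, 0 < ε → ∃ N, ∀ m ≥ N, ∀ n ≥ N, norm (v m - v n) < ε) →
    ∃ x, norm x < ∞ ∧ Tendsto (fun n => norm (v n - x)) atTop (𝓝 0)
  continuous_embedding : ∀ U ∈ 𝓝 (0 : A), ∃ ε : ℝ≥0∞, 0 < ε ∧ ∀ x, norm x < ε → x ∈ U

section Interpolation

variable {A : Type*} [AddCommGroup A]

/-- The sum of the spaces `{N₀ < ∞}` and `{N₁ < ∞}`. -/
def sumSpace (N₀ N₁ : A → ℝ≥0∞) : Set A :=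
  {f | ∃ f₀ f₁, f = f₀ + f₁ ∧ N₀ f₀ < ∞ ∧ N₁ f₁ < ∞}

/-- The Peetre `K`-functional `K(t, f)`, `0 < t < ∞`, of the couple of spaces with (quasi-)norms
`N₀` and `N₁`, which are `∞` outside the spaces. -/
def peetreK (N₀ N₁ : A → ℝ≥0∞) (t : ℝ≥0∞) (f : A) : ℝ≥0∞ :=
  ⨅ (f₀ : A) (f₁ : A) (_ : f = f₀ + f₁), (N₀ f₀ + t * N₁ f₁)

/-- The function `s ↦ s ^ (-θ) a(s) K(s, f)` on `(0, ∞)`. -/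
def weightedK (N₀ N₁ : A → ℝ≥0∞) (θ : ℝ) (a : ℝ → ℝ) (f : A) (s : ℝ) : ℝ≥0∞ :=
  ENNReal.ofReal (s ^ (-θ) * a s) * peetreK N₀ N₁ (ENNReal.ofReal s) f

open Classical in
/-- The (quasi-)norm of the space `X^R_{θ,b,E,a,F}` of the couple `(X₀, X₁)` with (quasi-)norms
`N₀`, `N₁`; the space consists of the `f ∈ X₀ + X₁` at which it is finite, and the value is `∞`
outside `X₀ + X₁`. -/
def rNorm (N₀ N₁ : A → ℝ≥0∞) (θ : ℝ) (b : ℝ → ℝ) (E : RISpace) (a : ℝ → ℝ) (F : RISpace)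
    (f : A) : ℝ≥0∞ :=
  if f ∈ sumSpace N₀ N₁ then
    E.tildeNorm fun t => ENNReal.ofReal (b t) * F.tildeNormOn (Ioi t) (weightedK N₀ N₁ θ a f)
  else ∞

end Interpolation

/-- `‖b‖_{Ẽ(0,u)}` for a positive function `b`. -/
def headNorm (E : RISpace) (b : ℝ → ℝ) (u : ℝ) : ℝ≥0∞ :=
  E.tildeNormOn (Ioo 0 u) fun t => ENNReal.ofReal (b t)

/-- `ρ(u) = u ^ (θ₁ - θ₀) a₀(u) ‖b₀‖_{Ẽ₀(0,u)} / (a₁(u) ‖b₁‖_{Ẽ₁(0,u)})`. -/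
def rhoRR (θ₀ θ₁ : ℝ) (a₀ a₁ b₀ b₁ : ℝ → ℝ) (E₀ E₁ : RISpace) (u : ℝ) : ℝ≥0∞ :=
  ENNReal.ofReal (u ^ (θ₁ - θ₀)) *
    ((ENNReal.ofReal (a₀ u) * headNorm E₀ b₀ u) / (ENNReal.ofReal (a₁ u) * headNorm E₁ b₁ u))

/-- The equivalence `x ∼ y` with constant `C`. -/
def EquivWithConst (C : ℝ≥0) (x y : ℝ≥0∞) : Prop :=
  x ≤ C * y ∧ y ≤ C * x

end

noncomputable section

/-! ### Equimeasurability and the rearrangement. -/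

section Rearrangement

variable {α β : Type*} [MeasurableSpace α] [MeasurableSpace β] {μ : Measure α} {ν : Measure β}

/-! The proof is a Holmstedt argument. Write W_j(u) = u^(-θ_j) a_j(u) and H_j(u) = ‖b_j‖ over (0,
u), so that ρ = W_0 H_0 / (W_1 H_1). Keeping only t < u and s > u in the norm of Y_j and using that
K(·, f) is nondecreasing gives W_j(u) H_j(u) K(u, f) ≲ ‖f‖ in Y_j (`exists_mul_headNorm_mul_le`).

Lower bound for the K-functional of (Y_0, Y_1): let f = g + h with g in Y_0 and h in Y_1. Since K(·,
f) ≲ K(·, g) + K(·, h), each of the three terms splits. The first term for g and the other two for h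
are parts of the norms of g and h. In the crossed terms the pointwise bound replaces K by a norm
times 1 / (W_j H_j). What is left is the norm of W_1 / (W_0 H_0) over tails and of W_0 / (W_1 H_1)
over (0, u). As θ_0 < θ_1, these quotients decay and grow like powers, so their norms are controlled
by endpoint values, and the factors at u cancel against ρ(u) (`exists_holmstedtSum_le`).

Upper bound: decompose f = f_0 + f_1 almost optimally for K(u, f) in (X_0, X_1). Then K(s, f_0) ≲
K(u, f) for all s and K(s, f_0) ≲ K(s, f) for s ≤ u, while K(s, f_1) ≲ (s / u) K(u, f) for all s and
K(s, f_1) ≲ K(s, f) for s ≥ u. Split the norms of f_0 and f_1 at u. Whatever is not already in the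
formula is at most a multiple of W_0 H_0 K(u, f) = ρ W_1 H_1 K(u, f) at u, because W_0(s) decays
(θ_0 > 0) and s W_1(s) grows (θ_1 < 1) like a power. The second term of the formula absorbs this
(`exists_add_le_holmstedtSum`).

The norm estimates rest on the invariance of dt / t under dilations and inversion: the norm of a
power-like function over (u, ∞) or (0, u) scales like its value at u. -/

theorem decreasingRearrangement_antitone (μ : Measure α) (f : α → ℝ≥0∞) :
    Antitone (decreasingRearrangement μ f) := fun _ _ hst =>
  sInf_le_sInf fun _ hl => le_trans hl (ENNReal.ofReal_le_ofReal hst)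

theorem decreasingRearrangement_measurable (μ : Measure α) (f : α → ℝ≥0∞) :
    Measurable (decreasingRearrangement μ f) :=
  (decreasingRearrangement_antitone μ f).measurable

theorem decreasingRearrangement_mono {f g : α → ℝ≥0∞} (h : f ≤ᵐ[μ] g) (t : ℝ) :
    decreasingRearrangement μ f t ≤ decreasingRearrangement μ g t := by
  refine sInf_le_sInf fun l hl => le_trans (measure_mono_ae ?_) hl
  filter_upwards [h] with x hx hlx
  exact lt_of_lt_of_le hlx hx

theorem decreasingRearrangement_congr {f : α → ℝ≥0∞} {g : β → ℝ≥0∞}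
    (h : ∀ l, μ {x | l < f x} = ν {x | l < g x}) :
    decreasingRearrangement μ f = decreasingRearrangement ν g := by
  funext t
  simp only [decreasingRearrangement, h]

theorem decreasingRearrangement_comp {T : β → α} (hT : MeasurePreserving T ν μ) {f : α → ℝ≥0∞}
    (hf : AEMeasurable f μ) :
    decreasingRearrangement ν (f ∘ T) = decreasingRearrangement μ f := by
  refine decreasingRearrangement_congr fun l => ?_
  exact hT.measure_preimage (nullMeasurableSet_lt aemeasurable_const hf)

/-- The distribution function is right continuous in the level, by continuity of the measure from
below, so the infimum defining the rearrangement can be handled level by level. No measurability of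
`f` is needed. -/
theorem lt_decreasingRearrangement_iff (f : α → ℝ≥0∞) (l : ℝ≥0∞) (t : ℝ) :
    l < decreasingRearrangement μ f t ↔ ENNReal.ofReal t < μ {x | l < f x} := by
  constructor
  · intro h
    by_contra! hle
    exact absurd h (not_lt.2 (sInf_le (show l ∈ {l | μ {x | l < f x} ≤ ENNReal.ofReal t} from hle)))
  · intro h
    have hl : l < ∞ := by
      refine lt_top_iff_ne_top.2 ?_
      rintro rfl
      simp at h
    obtain ⟨v, hv, hvl, hlim⟩ := exists_seq_strictAnti_tendsto' hl
    have hU : {x | l < f x} = ⋃ n, {x | v n < f x} := by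
      ext x
      simp only [mem_ofPred_eq, mem_iUnion]
      constructor
      · intro hx
        exact (hlim.eventually (gt_mem_nhds hx)).exists
      · rintro ⟨n, hn⟩
        exact (hvl n).1.trans hn
    have hmono : Monotone fun n => {x | v n < f x} := fun m n hmn x hx =>
      lt_of_le_of_lt (hv.antitone hmn) hx
    rw [hU, hmono.measure_iUnion] at h
    obtain ⟨n, hn⟩ := lt_iSup_iff.1 h
    refine lt_of_lt_of_le (hvl n).1 (le_sInf fun l' hl' => ?_)
    by_contra! hlt
    refine absurd (lt_of_lt_of_le hn (measure_mono fun x hx => ?_)) (not_lt.2 hl')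
    exact hlt.trans hx

theorem volume_Ioi_inter_ofReal_lt (m : ℝ≥0∞) :
    volume ({x : ℝ | ENNReal.ofReal x < m} ∩ Ioi 0) = m := by
  rcases eq_or_ne m ∞ with rfl | hm
  · simp
  · have : {x : ℝ | ENNReal.ofReal x < m} ∩ Ioi 0 = Ioo 0 m.toReal := by
      ext x
      simp only [mem_inter_iff, mem_ofPred_eq, mem_Ioi, mem_Ioo]
      constructor
      · rintro ⟨h1, h2⟩
        exact ⟨h2, (ENNReal.ofReal_lt_iff_lt_toReal h2.le hm).1 h1⟩
      · rintro ⟨h1, h2⟩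
        exact ⟨(ENNReal.ofReal_lt_iff_lt_toReal h1.le hm).2 h2, h1⟩
    rw [this, Real.volume_Ioo, sub_zero, ENNReal.ofReal_toReal hm]

/-- The set where the rearrangement exceeds `l` is an initial interval of length `μ {f > l}`, so the
rearrangement is equimeasurable with `f`. -/
theorem decreasingRearrangement_idem (f : α → ℝ≥0∞) :
    decreasingRearrangement lebesguePos (decreasingRearrangement μ f) =
      decreasingRearrangement μ f := by
  refine decreasingRearrangement_congr fun l => ?_
  rw [lebesguePos, Measure.restrict_apply
    (measurableSet_lt measurable_const (decreasingRearrangement_measurable μ f))]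
  simp only [lt_decreasingRearrangement_iff]
  exact volume_Ioi_inter_ofReal_lt _

end Rearrangement

/-! ### The measure dt / t and its symmetries. -/

section HomogeneousMeasure

theorem measurePreserving_exp : MeasurePreserving Real.exp volume homogeneousPos := by
  refine ⟨Real.measurable_exp, Measure.ext fun s hs => ?_⟩
  rw [Measure.map_apply Real.measurable_exp hs, homogeneousPos, withDensity_apply _ hs,
    lebesguePos, Measure.restrict_restrict hs]
  have him : s ∩ Ioi 0 = Real.exp '' (Real.exp ⁻¹' s) := by
    rw [image_preimage_eq_inter_range, Real.range_exp]
  rw [him, lintegral_image_eq_lintegral_abs_deriv_mul (Real.measurable_exp hs)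
    (fun x _ => (Real.hasDerivAt_exp x).hasDerivWithinAt) (Real.exp_injective.injOn)]
  rw [setLIntegral_congr_fun (g := fun _ => 1) (Real.measurable_exp hs), setLIntegral_one]
  intro x _
  have := Real.exp_pos x
  simp only
  rw [← ENNReal.ofReal_mul (abs_nonneg _), abs_of_pos this, mul_inv_cancel₀ this.ne',
    ENNReal.ofReal_one]

theorem homogeneousPos_absolutelyContinuous : homogeneousPos ≪ lebesguePos :=
  withDensity_absolutelyContinuous _ _

theorem ae_homogeneousPos_pos : ∀ᵐ t ∂homogeneousPos, 0 < t :=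
  homogeneousPos_absolutelyContinuous.ae_le (ae_restrict_mem measurableSet_Ioi)

theorem ae_homogeneousPos_ne (u : ℝ) : ∀ᵐ t ∂homogeneousPos, t ≠ u := by
  refine homogeneousPos_absolutelyContinuous.ae_le (ae_restrict_of_ae ?_)
  simp [ae_iff]

/-- A map of `ℝ` into itself that permutes unit intervals so that `[0, ∞)` is carried onto `ℝ`. -/
def unfoldHalfLine (x : ℝ) : ℝ :=
  x - ⌊x⌋ + (Equiv.intEquivNat.symm ⌊x⌋.toNat : ℤ)

theorem measurable_unfoldHalfLine : Measurable unfoldHalfLine := by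
  have h : Measurable fun z : ℤ => ((Equiv.intEquivNat.symm z.toNat : ℤ) : ℝ) := measurable_from_top
  exact (measurable_id.sub (measurable_from_top.comp Int.measurable_floor)).add
    (h.comp Int.measurable_floor)

theorem measurePreserving_unfoldHalfLine :
    MeasurePreserving unfoldHalfLine lebesguePos volume := by
  refine ⟨measurable_unfoldHalfLine, Measure.ext fun s hs => ?_⟩
  set e : ℕ → ℤ := fun n => Equiv.intEquivNat.symm n with he
  have hI : ∀ z : ℤ, MeasurableSet (s ∩ Ico (z : ℝ) (z + 1)) := fun z => hs.inter measurableSet_Ico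
  rw [Measure.map_apply measurable_unfoldHalfLine hs, lebesguePos, Measure.restrict_congr_set Ioi_ae_eq_Ici,
    Measure.restrict_apply (measurable_unfoldHalfLine hs)]
  have hpre : unfoldHalfLine ⁻¹' s ∩ Ici 0 =
      ⋃ n : ℕ, (fun x => x + ((e n : ℝ) - n)) ⁻¹' (s ∩ Ico (e n : ℝ) (e n + 1)) := by
    ext x
    simp only [mem_inter_iff, mem_preimage, mem_Ici, mem_iUnion, mem_Ico]
    constructor
    · rintro ⟨h1, h2⟩
      have hfl : ((⌊x⌋.toNat : ℕ) : ℝ) = ⌊x⌋ := by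
        have := Int.toNat_of_nonneg (Int.floor_nonneg.2 h2)
        exact_mod_cast congrArg (Int.cast : ℤ → ℝ) this
      have h3 := Int.floor_le x
      have h4 := Int.lt_floor_add_one x
      refine ⟨⌊x⌋.toNat, ?_, ?_, ?_⟩
      · convert h1 using 1
        rw [hfl, unfoldHalfLine]; ring
      · rw [hfl]; linarith
      · rw [hfl]; linarith
    · rintro ⟨n, h1, h2, h3⟩
      have hfl : ⌊x⌋ = n := by
        rw [Int.floor_eq_iff]; push_cast; constructor <;> linarith
      have hn : (0 : ℝ) ≤ n := n.cast_nonneg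
      refine ⟨?_, by linarith⟩
      convert h1 using 1
      rw [unfoldHalfLine, hfl, Int.toNat_natCast]; push_cast; ring
  have hs' : s = ⋃ z : ℤ, s ∩ Ico (z : ℝ) (z + 1) := by
    rw [← inter_iUnion, iUnion_Ico_intCast, inter_univ]
  have hdis : Pairwise (Function.onFun Disjoint fun z : ℤ => s ∩ Ico (z : ℝ) (z + 1)) := by
    intro i j hij
    exact (pairwise_disjoint_Ico_intCast ℝ hij).mono inter_subset_right inter_subset_right
  rw [hpre, measure_iUnion]
  · conv_rhs => rw [hs', measure_iUnion hdis hI]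
    rw [← Equiv.tsum_eq Equiv.intEquivNat.symm]
    exact tsum_congr fun n => measure_preimage_add_right _ _ _
  · intro i j hij
    refine disjoint_left.2 fun x hx hy => hij ?_
    simp only [mem_preimage, mem_inter_iff, mem_Ico] at hx hy
    have h1 : ⌊x⌋ = i := by
      rw [Int.floor_eq_iff]; push_cast; constructor <;> linarith [hx.2.1, hx.2.2]
    have h2 : ⌊x⌋ = j := by
      rw [Int.floor_eq_iff]; push_cast; constructor <;> linarith [hy.2.1, hy.2.2]
    exact_mod_cast h1.symm.trans h2
  · exact fun n => (measurable_add_const _) (hI _)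

/-- Composition with this map turns functions on the space with measure dt / t into equimeasurable
functions on the half-line with Lebesgue measure. This transports the axioms of `E` to `tildeNorm`;
the triangle inequality in particular cannot be read off pointwise from rearrangements. -/
theorem measurePreserving_exp_unfoldHalfLine :
    MeasurePreserving (Real.exp ∘ unfoldHalfLine) lebesguePos homogeneousPos :=
  measurePreserving_exp.comp measurePreserving_unfoldHalfLine

theorem measurePreserving_homogeneousPos_of_exp {T : ℝ → ℝ} {R : ℝ → ℝ} (hT : Measurable T)
    (hR : MeasurePreserving R volume volume) (h : ∀ x, T (Real.exp x) = Real.exp (R x)) :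
    MeasurePreserving T homogeneousPos homogeneousPos := by
  refine ⟨hT, ?_⟩
  rw [← measurePreserving_exp.map_eq, Measure.map_map hT Real.measurable_exp,
    show T ∘ Real.exp = Real.exp ∘ R from funext h,
    ← Measure.map_map Real.measurable_exp hR.measurable, hR.map_eq]

theorem measurePreserving_mul_homogeneousPos {c : ℝ} (hc : 0 < c) :
    MeasurePreserving (fun t => c * t) homogeneousPos homogeneousPos := by
  refine measurePreserving_homogeneousPos_of_exp (measurable_const_mul c)
    (measurePreserving_add_left volume (Real.log c)) fun x => ?_
  rw [Real.exp_add, Real.exp_log hc]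

theorem measurePreserving_inv_homogeneousPos :
    MeasurePreserving (fun t => t⁻¹) homogeneousPos homogeneousPos :=
  measurePreserving_homogeneousPos_of_exp measurable_inv (Measure.measurePreserving_neg volume)
    fun x => (Real.exp_neg x).symm

theorem homogeneousPos_Ioo : homogeneousPos (Ioo 1 2) = ENNReal.ofReal (Real.log 2) := by
  rw [← measurePreserving_exp.measure_preimage measurableSet_Ioo.nullMeasurableSet]
  have : Real.exp ⁻¹' Ioo 1 2 = Ioo 0 (Real.log 2) := by
    ext x
    simp [Real.lt_log_iff_exp_lt]
  rw [this, Real.volume_Ioo, sub_zero]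

end HomogeneousMeasure

/-! ### The norm of Ẽ as a function norm for dt / t. -/

namespace RISpace

variable (E : RISpace)

theorem norm_congr_of_rearrangement {f g : ℝ → ℝ≥0∞} (hf : AEMeasurable f lebesguePos)
    (hg : AEMeasurable g lebesguePos)
    (h : decreasingRearrangement lebesguePos f = decreasingRearrangement lebesguePos g) :
    E.norm f = E.norm g :=
  le_antisymm (E.norm_le_of_rearrangement_le f g hf hg fun t _ => (congrFun h t).le)
    (E.norm_le_of_rearrangement_le g f hg hf fun t _ => (congrFun h t).ge)

theorem tildeNorm_eq_of_measurePreserving {T : ℝ → ℝ}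
    (hT : MeasurePreserving T lebesguePos homogeneousPos) {f : ℝ → ℝ≥0∞}
    (hf : AEMeasurable f homogeneousPos) : E.tildeNorm f = E.norm (f ∘ T) := by
  refine E.norm_congr_of_rearrangement (decreasingRearrangement_measurable _ _).aemeasurable
    (hf.comp_quasiMeasurePreserving hT.quasiMeasurePreserving) ?_
  rw [decreasingRearrangement_idem, decreasingRearrangement_comp hT hf]

theorem tildeNorm_comp {T : ℝ → ℝ} (hT : MeasurePreserving T homogeneousPos homogeneousPos)
    {f : ℝ → ℝ≥0∞} (hf : AEMeasurable f homogeneousPos) :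
    E.tildeNorm (f ∘ T) = E.tildeNorm f := by
  rw [tildeNorm, decreasingRearrangement_comp hT hf, tildeNorm]

theorem tildeNorm_mono_ae {f g : ℝ → ℝ≥0∞} (h : f ≤ᵐ[homogeneousPos] g) :
    E.tildeNorm f ≤ E.tildeNorm g :=
  E.norm_mono _ _ (decreasingRearrangement_measurable _ _).aemeasurable
    (decreasingRearrangement_measurable _ _).aemeasurable
    (Eventually.of_forall (decreasingRearrangement_mono h))

theorem tildeNorm_mono {f g : ℝ → ℝ≥0∞} (h : ∀ t, 0 < t → f t ≤ g t) :
    E.tildeNorm f ≤ E.tildeNorm g :=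
  E.tildeNorm_mono_ae (ae_homogeneousPos_pos.mono h)

/-- Points are null sets, so splitting a half-line at `u` into open pieces loses nothing. -/
theorem tildeNorm_mono_of_ne (u : ℝ) {f g : ℝ → ℝ≥0∞} (h : ∀ t, 0 < t → t ≠ u → f t ≤ g t) :
    E.tildeNorm f ≤ E.tildeNorm g := by
  refine E.tildeNorm_mono_ae ?_
  filter_upwards [ae_homogeneousPos_pos, ae_homogeneousPos_ne u] using h

theorem tildeNorm_add_le {f g : ℝ → ℝ≥0∞} (hf : AEMeasurable f homogeneousPos)
    (hg : AEMeasurable g homogeneousPos) :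
    E.tildeNorm (fun t => f t + g t) ≤ E.tildeNorm f + E.tildeNorm g := by
  have hT := measurePreserving_exp_unfoldHalfLine
  rw [E.tildeNorm_eq_of_measurePreserving hT hf, E.tildeNorm_eq_of_measurePreserving hT hg,
    E.tildeNorm_eq_of_measurePreserving hT (f := fun t => f t + g t) (hf.add hg)]
  exact E.norm_add_le _ _ (hf.comp_quasiMeasurePreserving hT.quasiMeasurePreserving) (hg.comp_quasiMeasurePreserving hT.quasiMeasurePreserving)

theorem tildeNorm_iSup {f : ℕ → ℝ → ℝ≥0∞} (hf : ∀ n, AEMeasurable (f n) homogeneousPos)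
    (hmono : ∀ n t, f n t ≤ f (n + 1) t) :
    E.tildeNorm (fun t => ⨆ n, f n t) = ⨆ n, E.tildeNorm (f n) := by
  have hT := measurePreserving_exp_unfoldHalfLine
  rw [E.tildeNorm_eq_of_measurePreserving hT (AEMeasurable.iSup hf)]
  simp only [fun n => E.tildeNorm_eq_of_measurePreserving hT (hf n)]
  exact E.fatou (fun n => f n ∘ _) (fun n => (hf n).comp_quasiMeasurePreserving hT.quasiMeasurePreserving)
    fun n => Eventually.of_forall fun x => hmono n _

theorem tildeNorm_zero : E.tildeNorm (fun _ => 0) = 0 := by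
  have hT := measurePreserving_exp_unfoldHalfLine
  rw [E.tildeNorm_eq_of_measurePreserving hT aemeasurable_const]
  exact (E.norm_eq_zero_iff _ aemeasurable_const).2 (Eventually.of_forall fun _ => rfl)

theorem tildeNorm_const_mul (c : ℝ≥0∞) {f : ℝ → ℝ≥0∞} (hf : AEMeasurable f homogeneousPos) :
    E.tildeNorm (fun t => c * f t) = c * E.tildeNorm f := by
  have hT := measurePreserving_exp_unfoldHalfLine
  have hnn : ∀ c : ℝ≥0, E.tildeNorm (fun t => c * f t) = c * E.tildeNorm f := fun c => by
    rw [E.tildeNorm_eq_of_measurePreserving hT hf,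
      E.tildeNorm_eq_of_measurePreserving hT (hf.const_mul _)]
    exact E.norm_const_mul c _ (hf.comp_quasiMeasurePreserving hT.quasiMeasurePreserving)
  induction c with
  | coe c => exact hnn c
  | top =>
    -- Homogeneity is assumed only for finite constants; the factor `∞` is reached by the Fatou
    -- property along `n * f`.
    have h := E.tildeNorm_iSup (f := fun n t => ((n : ℝ≥0) : ℝ≥0∞) * f t)
      (fun n => hf.const_mul _) (fun n t => by gcongr; simp)
    simp only [hnn, ← ENNReal.iSup_mul] at h
    simpa [ENNReal.iSup_natCast] using h

theorem tildeNorm_sum_le {f : ℕ → ℝ → ℝ≥0∞} (hf : ∀ n, AEMeasurable (f n) homogeneousPos)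
    (n : ℕ) : E.tildeNorm (fun t => ∑ i ∈ Finset.range n, f i t) ≤
      ∑ i ∈ Finset.range n, E.tildeNorm (f i) := by
  induction n with
  | zero => simp [E.tildeNorm_zero]
  | succ n ih =>
    simp only [Finset.sum_range_succ]
    exact (E.tildeNorm_add_le (Finset.aemeasurable_fun_sum _ fun i _ => hf i) (hf n)).trans
      (add_le_add_left ih _)

theorem tildeNorm_tsum_le {f : ℕ → ℝ → ℝ≥0∞} (hf : ∀ n, AEMeasurable (f n) homogeneousPos) :
    E.tildeNorm (fun t => ∑' n, f n t) ≤ ∑' n, E.tildeNorm (f n) := by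
  simp only [ENNReal.tsum_eq_iSup_nat]
  rw [E.tildeNorm_iSup (fun n => Finset.aemeasurable_fun_sum _ fun i _ => hf i)]
  · exact iSup_mono fun n => E.tildeNorm_sum_le hf n
  · intro n t
    exact Finset.sum_le_sum_of_subset (Finset.range_mono n.le_succ)

theorem tildeNorm_eq_zero_iff {f : ℝ → ℝ≥0∞} (hf : Measurable f) :
    E.tildeNorm f = 0 ↔ f =ᵐ[homogeneousPos] 0 := by
  have hT := measurePreserving_exp_unfoldHalfLine
  rw [E.tildeNorm_eq_of_measurePreserving hT hf.aemeasurable,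
    E.norm_eq_zero_iff _ (hf.comp hT.measurable).aemeasurable, ← hT.map_eq]
  exact (ae_map_iff hT.measurable.aemeasurable (hf (measurableSet_singleton 0))).symm

theorem tildeNorm_indicator_Ioo_lt_top :
    E.tildeNorm ((Ioo 1 2 : Set ℝ).indicator fun _ => 1) < ∞ := by
  have hT := measurePreserving_exp_unfoldHalfLine
  rw [E.tildeNorm_eq_of_measurePreserving hT
    ((measurable_const.indicator measurableSet_Ioo).aemeasurable)]
  refine E.norm_indicator_lt_top ((Real.exp ∘ unfoldHalfLine) ⁻¹' Ioo 1 2)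
    (hT.measurable measurableSet_Ioo) ?_
  rw [hT.measure_preimage measurableSet_Ioo.nullMeasurableSet, homogeneousPos_Ioo]
  exact ENNReal.ofReal_lt_top

theorem tildeNorm_indicator_Ioo_ne_zero :
    E.tildeNorm ((Ioo 1 2 : Set ℝ).indicator fun _ => 1) ≠ 0 := by
  rw [Ne, E.tildeNorm_eq_zero_iff (measurable_const.indicator measurableSet_Ioo),
    indicator_ae_eq_zero]
  have : Function.support (fun _ : ℝ => (1 : ℝ≥0∞)) = univ := by ext; simp
  rw [this, inter_univ, homogeneousPos_Ioo]
  simpa using Real.log_pos one_lt_two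

end RISpace

/-! ### One-sided power growth; slowly varying functions. -/

section PowerGrowth

/-- `w` grows at most like `t ^ α` on `(0, ∞)`, up to a constant. -/
def UpperPower (α : ℝ) (w : ℝ → ℝ≥0∞) : Prop :=
  ∃ C : ℝ≥0, 0 < C ∧ ∀ s t, 0 < s → s ≤ t → w t ≤ C * ENNReal.ofReal ((t / s) ^ α) * w s

/-- `w` grows at least like `t ^ α` on `(0, ∞)`, up to a constant. -/
def LowerPower (α : ℝ) (w : ℝ → ℝ≥0∞) : Prop :=
  ∃ C : ℝ≥0, 0 < C ∧ ∀ s t, 0 < s → s ≤ t → w s ≤ C * ENNReal.ofReal ((s / t) ^ α) * w t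

variable {α β : ℝ} {v w : ℝ → ℝ≥0∞}

theorem UpperPower.mul (hv : UpperPower α v) (hw : UpperPower β w) :
    UpperPower (α + β) (fun t => v t * w t) := by
  obtain ⟨C, hC, h⟩ := hv
  obtain ⟨D, hD, h'⟩ := hw
  refine ⟨C * D, mul_pos hC hD, fun s t hs hst => (mul_le_mul' (h s t hs hst) (h' s t hs hst)).trans
    (le_of_eq ?_)⟩
  have ht := hs.trans_le hst
  rw [Real.rpow_add (by positivity), ENNReal.ofReal_mul (by positivity), ENNReal.coe_mul]
  ring

theorem LowerPower.mul (hv : LowerPower α v) (hw : LowerPower β w) :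
    LowerPower (α + β) (fun t => v t * w t) := by
  obtain ⟨C, hC, h⟩ := hv
  obtain ⟨D, hD, h'⟩ := hw
  refine ⟨C * D, mul_pos hC hD, fun s t hs hst => (mul_le_mul' (h s t hs hst) (h' s t hs hst)).trans
    (le_of_eq ?_)⟩
  have ht := hs.trans_le hst
  rw [Real.rpow_add (by positivity), ENNReal.ofReal_mul (by positivity), ENNReal.coe_mul]
  ring

theorem ENNReal.inv_le_mul_inv_of_le {c x y : ℝ≥0∞} (hc : c ≠ 0) (hc' : c ≠ ∞) (h : x ≤ c * y) :
    y⁻¹ ≤ c * x⁻¹ := by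
  have h1 := ENNReal.inv_le_inv.2 h
  rw [ENNReal.mul_inv (Or.inl hc) (Or.inl hc')] at h1
  calc y⁻¹ = c * (c⁻¹ * y⁻¹) := by rw [← mul_assoc, ENNReal.mul_inv_cancel hc hc', one_mul]
    _ ≤ c * x⁻¹ := by gcongr

theorem UpperPower.inv (hw : UpperPower α w) : LowerPower (-α) (fun t => (w t)⁻¹) := by
  obtain ⟨C, hC, h⟩ := hw
  refine ⟨C, hC, fun s t hs hst => ?_⟩
  have ht := hs.trans_le hst
  rw [Real.rpow_neg (by positivity), ← Real.inv_rpow (by positivity), inv_div]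
  refine ENNReal.inv_le_mul_inv_of_le ?_ (by finiteness) (h s t hs hst)
  have : 0 < (t / s) ^ α := by positivity
  simp [hC.ne', this]

theorem LowerPower.inv (hw : LowerPower α w) : UpperPower (-α) (fun t => (w t)⁻¹) := by
  obtain ⟨C, hC, h⟩ := hw
  refine ⟨C, hC, fun s t hs hst => ?_⟩
  have ht := hs.trans_le hst
  rw [Real.rpow_neg (by positivity), ← Real.inv_rpow (by positivity), inv_div]
  refine ENNReal.inv_le_mul_inv_of_le ?_ (by finiteness) (h s t hs hst)
  have : 0 < (s / t) ^ α := by positivity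
  simp [hC.ne', this]

theorem upperPower_rpow (α : ℝ) : UpperPower α (fun t => ENNReal.ofReal (t ^ α)) := by
  refine ⟨1, one_pos, fun s t hs hst => le_of_eq ?_⟩
  have ht := hs.trans_le hst
  rw [ENNReal.coe_one, one_mul, ← ENNReal.ofReal_mul (by positivity), Real.div_rpow ht.le hs.le,
    div_mul_cancel₀ _ (by positivity)]

theorem lowerPower_rpow (α : ℝ) : LowerPower α (fun t => ENNReal.ofReal (t ^ α)) := by
  refine ⟨1, one_pos, fun s t hs hst => le_of_eq ?_⟩
  have ht := hs.trans_le hst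
  rw [ENNReal.coe_one, one_mul, ← ENNReal.ofReal_mul (by positivity), Real.div_rpow hs.le ht.le,
    div_mul_cancel₀ _ (by positivity)]

theorem lowerPower_zero_of_monotone (hw : Monotone w) : LowerPower 0 w :=
  ⟨1, one_pos, fun s t _ hst => by simpa using hw hst⟩

/-- Passing to the monotone equivalent of `t ^ (-ε) * b t` at `t` and back at `s` costs the
equivalence constant twice, hence `C * C`. -/
theorem SlowlyVarying.upperPower {b : ℝ → ℝ} (hb : SlowlyVarying b) {ε : ℝ} (hε : 0 < ε) :
    UpperPower ε (fun t => ENNReal.ofReal (b t)) := by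
  obtain ⟨g, hg, C, hC, h⟩ := hb.equiv_antitone ε hε
  refine ⟨(C * C).toNNReal, by simpa using mul_pos hC hC, fun s t hs hst => ?_⟩
  have ht := hs.trans_le hst
  rw [← ENNReal.ofReal, ← ENNReal.ofReal_mul (by positivity), ← ENNReal.ofReal_mul (by positivity)]
  refine ENNReal.ofReal_le_ofReal ?_
  have h1 : t ^ (-ε) * b t ≤ C * (C * (s ^ (-ε) * b s)) :=
    (h t ht).1.trans (mul_le_mul_of_nonneg_left ((hg hs ht hst).trans (h s hs).2) hC.le)
  have h2 : t ^ ε * t ^ (-ε) = 1 := by rw [← Real.rpow_add ht]; simp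
  calc b t = t ^ ε * (t ^ (-ε) * b t) := by rw [← mul_assoc, h2, one_mul]
    _ ≤ t ^ ε * (C * (C * (s ^ (-ε) * b s))) := by gcongr
    _ = _ := by rw [Real.div_rpow ht.le hs.le, Real.rpow_neg hs.le]; ring

theorem SlowlyVarying.lowerPower {b : ℝ → ℝ} (hb : SlowlyVarying b) {ε : ℝ} (hε : 0 < ε) :
    LowerPower (-ε) (fun t => ENNReal.ofReal (b t)) := by
  obtain ⟨g, hg, C, hC, h⟩ := hb.equiv_monotone ε hε
  refine ⟨(C * C).toNNReal, by simpa using mul_pos hC hC, fun s t hs hst => ?_⟩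
  have ht := hs.trans_le hst
  rw [← ENNReal.ofReal, ← ENNReal.ofReal_mul (by positivity), ← ENNReal.ofReal_mul (by positivity)]
  refine ENNReal.ofReal_le_ofReal ?_
  have h1 : s ^ ε * b s ≤ C * (C * (t ^ ε * b t)) :=
    (h s hs).1.trans (mul_le_mul_of_nonneg_left ((hg hs ht hst).trans (h t ht).2) hC.le)
  have h2 : s ^ (-ε) * s ^ ε = 1 := by rw [← Real.rpow_add hs]; simp
  calc b s = s ^ (-ε) * (s ^ ε * b s) := by rw [← mul_assoc, h2, one_mul]
    _ ≤ s ^ (-ε) * (C * (C * (t ^ ε * b t))) := by gcongr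
    _ = _ := by rw [Real.div_rpow hs.le ht.le, Real.rpow_neg ht.le]; field_simp

theorem SlowlyVarying.ofReal_ne_zero {b : ℝ → ℝ} (hb : SlowlyVarying b) {t : ℝ} (ht : 0 < t) :
    ENNReal.ofReal (b t) ≠ 0 := by
  simpa using hb.pos t ht

theorem SlowlyVarying.aemeasurable_ofReal {b : ℝ → ℝ} (hb : SlowlyVarying b) :
    AEMeasurable (fun t => ENNReal.ofReal (b t)) homogeneousPos :=
  (hb.aemeasurable.mono_ac homogeneousPos_absolutelyContinuous).ennreal_ofReal

end PowerGrowth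

/-! ### Norms of power-like functions over half-lines. -/

namespace RISpace

variable (E : RISpace)

theorem tildeNorm_comp_div {f : ℝ → ℝ≥0∞} (hf : AEMeasurable f homogeneousPos) {u : ℝ}
    (hu : 0 < u) : E.tildeNorm (fun t => f (t / u)) = E.tildeNorm f := by
  rw [← E.tildeNorm_comp (measurePreserving_mul_homogeneousPos (inv_pos.2 hu)) hf]
  congr 1; funext t; simp [div_eq_inv_mul]

theorem tildeNorm_comp_div_left {f : ℝ → ℝ≥0∞} (hf : AEMeasurable f homogeneousPos) {u : ℝ}
    (hu : 0 < u) : E.tildeNorm (fun t => f (u / t)) = E.tildeNorm f := by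
  rw [← E.tildeNorm_comp ((measurePreserving_mul_homogeneousPos hu).comp
    measurePreserving_inv_homogeneousPos) hf]
  congr 1

theorem tildeNormOn_mono {S T : Set ℝ} {f g : ℝ → ℝ≥0∞} (u : ℝ)
    (hST : ∀ t ∈ S, 0 < t → t ≠ u → t ∈ T)
    (h : ∀ t ∈ S, 0 < t → t ≠ u → f t ≤ g t) : E.tildeNormOn S f ≤ E.tildeNormOn T g := by
  refine E.tildeNorm_mono_of_ne u fun t ht htu => indicator_apply_le' (fun hS => ?_) (fun _ => zero_le)
  rw [indicator_of_mem (hST t hS ht htu)]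
  exact h t hS ht htu

theorem tildeNormOn_const_mul (c : ℝ≥0∞) {S : Set ℝ} (hS : MeasurableSet S) {f : ℝ → ℝ≥0∞}
    (hf : AEMeasurable f homogeneousPos) :
    E.tildeNormOn S (fun t => c * f t) = c * E.tildeNormOn S f := by
  rw [tildeNormOn, tildeNormOn, ← E.tildeNorm_const_mul c (hf.indicator hS)]
  congr 1; funext t
  by_cases h : t ∈ S <;> simp [h]

theorem tildeNormOn_add_le {S : Set ℝ} (hS : MeasurableSet S) {f g : ℝ → ℝ≥0∞}
    (hf : AEMeasurable f homogeneousPos) (hg : AEMeasurable g homogeneousPos) :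
    E.tildeNormOn S (fun t => f t + g t) ≤ E.tildeNormOn S f + E.tildeNormOn S g := by
  rw [tildeNormOn, show S.indicator (fun t => f t + g t) = fun t => S.indicator f t + S.indicator g t
    from indicator_add S f g]
  exact E.tildeNorm_add_le (hf.indicator hS) (hg.indicator hS)

theorem tildeNormOn_le_add {R S T : Set ℝ} (u : ℝ) (hS : MeasurableSet S) (hT : MeasurableSet T)
    {f : ℝ → ℝ≥0∞} (hf : AEMeasurable f homogeneousPos)
    (h : ∀ t ∈ R, 0 < t → t ≠ u → t ∈ S ∨ t ∈ T) :
    E.tildeNormOn R f ≤ E.tildeNormOn S f + E.tildeNormOn T f := by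
  refine le_trans (E.tildeNorm_mono_of_ne u fun t ht htu => ?_)
    (E.tildeNorm_add_le (hf.indicator hS) (hf.indicator hT))
  refine indicator_apply_le' (fun hR => ?_) (fun _ => zero_le)
  rcases h t hR ht htu with h | h
  · rw [indicator_of_mem h]; exact le_self_add
  · rw [indicator_of_mem h]; exact le_add_self

/-- On the dyadic interval [2^n, 2^(n+1)) the function is at most 2^(-εn), and by dilation
invariance all these intervals have indicators of the same norm. The bound is a geometric series. -/
theorem tildeNormOn_Ioi_rpow_lt_top {ε : ℝ} (hε : 0 < ε) :
    E.tildeNormOn (Ioi 1) (fun t => ENNReal.ofReal (t ^ (-ε))) < ∞ := by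
  set χ : ℝ → ℝ≥0∞ := (Ioo 1 2 : Set ℝ).indicator fun _ => 1 with hχ
  have hχm : Measurable χ := measurable_const.indicator measurableSet_Ioo
  set χ' : ℝ → ℝ≥0∞ := (Ico 1 2 : Set ℝ).indicator fun _ => 1 with hχ'
  have hχm' : Measurable χ' := measurable_const.indicator measurableSet_Ico
  set M := E.tildeNorm χ with hM
  have hMχ' : E.tildeNorm χ' ≤ M := E.tildeNormOn_mono 1
    (fun t ht _ hne => ⟨lt_of_le_of_ne ht.1 hne.symm, ht.2⟩) fun _ _ _ _ => le_rfl
  set q : ℝ := 2 ^ (-ε) with hq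
  have hq0 : 0 < q := by positivity
  have hq1 : q < 1 := Real.rpow_lt_one_of_one_lt_of_neg one_lt_two (neg_neg_of_pos hε)
  have hpow : ∀ n : ℕ, (0 : ℝ) < 2 ^ n := fun n => by positivity
  calc E.tildeNormOn (Ioi 1) (fun t => ENNReal.ofReal (t ^ (-ε)))
      ≤ E.tildeNorm (fun t => ∑' n : ℕ, ENNReal.ofReal q ^ n * χ' (t / 2 ^ n)) := by
        refine E.tildeNorm_mono fun t _ => indicator_apply_le' (fun ht => ?_) (fun _ => zero_le)
        obtain ⟨n, hn1, hn2⟩ := exists_nat_pow_near (le_of_lt (mem_Ioi.1 ht)) one_lt_two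
        refine le_trans ?_ (ENNReal.le_tsum n)
        have hmem : t / 2 ^ n ∈ Ico (1 : ℝ) 2 := by
          constructor
          · rwa [le_div_iff₀ (hpow n), one_mul]
          · rwa [div_lt_iff₀ (hpow n), ← pow_succ']
        rw [hχ', indicator_of_mem hmem, mul_one, ← ENNReal.ofReal_pow hq0.le]
        refine ENNReal.ofReal_le_ofReal ?_
        rw [hq, ← Real.rpow_natCast, ← Real.rpow_mul zero_le_two, mul_comm, Real.rpow_mul zero_le_two,
          Real.rpow_natCast]
        exact Real.rpow_le_rpow_of_nonpos (hpow n) hn1 (by linarith)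
    _ ≤ ∑' n : ℕ, E.tildeNorm (fun t => ENNReal.ofReal q ^ n * χ' (t / 2 ^ n)) := by
        refine E.tildeNorm_tsum_le fun n => Measurable.aemeasurable ?_
        exact (hχm'.comp (measurable_id.div_const _)).const_mul _
    _ ≤ ∑' n : ℕ, ENNReal.ofReal q ^ n * M := by
        refine ENNReal.tsum_le_tsum fun n => ?_
        rw [E.tildeNorm_const_mul _
          (f := fun t => χ' (t / 2 ^ n)) (hχm'.comp (measurable_id.div_const _)).aemeasurable,
          E.tildeNorm_comp_div hχm'.aemeasurable (hpow n)]
        gcongr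
    _ = (1 - ENNReal.ofReal q)⁻¹ * M := by rw [ENNReal.tsum_mul_right, ENNReal.tsum_geometric]
    _ < ∞ := by
        refine ENNReal.mul_lt_top ?_ E.tildeNorm_indicator_Ioo_lt_top
        rw [ENNReal.inv_lt_top, tsub_pos_iff_lt]
        simpa using hq1

theorem tildeNormOn_Ioi_le_of_upperPower {ε : ℝ} (hε : 0 < ε) {w : ℝ → ℝ≥0∞}
    (hw : UpperPower (-ε) w) :
    ∃ C : ℝ≥0, ∀ u, 0 < u → E.tildeNormOn (Ioi u) w ≤ C * w u := by
  obtain ⟨C, hC, h⟩ := hw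
  set g : ℝ → ℝ≥0∞ := (Ioi 1).indicator (fun t => ENNReal.ofReal (t ^ (-ε))) with hg
  have hgm : Measurable g := by
    refine Measurable.indicator ?_ measurableSet_Ioi
    fun_prop
  refine ⟨C * (E.tildeNorm g).toNNReal, fun u hu => ?_⟩
  have hfin : E.tildeNorm g ≠ ∞ := (E.tildeNormOn_Ioi_rpow_lt_top hε).ne
  calc E.tildeNormOn (Ioi u) w ≤ E.tildeNorm (fun t => (C * w u) * g (t / u)) := by
        refine E.tildeNorm_mono fun t ht => indicator_apply_le' (fun hut => ?_) (fun _ => zero_le)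
        have : t / u ∈ Ioi (1 : ℝ) := (one_lt_div hu).2 hut
        rw [hg, indicator_of_mem this]
        exact (h u t hu (le_of_lt hut)).trans (le_of_eq (by ring))
    _ = C * w u * E.tildeNorm g := by
        rw [E.tildeNorm_const_mul _ (f := fun t => g (t / u))
          (hgm.comp (measurable_id.div_const _)).aemeasurable, E.tildeNorm_comp_div hgm.aemeasurable hu]
    _ = _ := by rw [ENNReal.coe_mul, ENNReal.coe_toNNReal hfin]; ring

/-- The inversion `t ↦ u / t` carries (0, u) to (1, ∞) and growth to decay, so the same reference
function serves as for tails. -/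
theorem tildeNormOn_Ioo_le_of_lowerPower {ε : ℝ} (hε : 0 < ε) {w : ℝ → ℝ≥0∞}
    (hw : LowerPower ε w) :
    ∃ C : ℝ≥0, ∀ u, 0 < u → E.tildeNormOn (Ioo 0 u) w ≤ C * w u := by
  obtain ⟨C, hC, h⟩ := hw
  set g : ℝ → ℝ≥0∞ := (Ioi 1).indicator (fun t => ENNReal.ofReal (t ^ (-ε))) with hg
  have hgm : Measurable g := by
    refine Measurable.indicator ?_ measurableSet_Ioi
    fun_prop
  refine ⟨C * (E.tildeNorm g).toNNReal, fun u hu => ?_⟩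
  have hfin : E.tildeNorm g ≠ ∞ := (E.tildeNormOn_Ioi_rpow_lt_top hε).ne
  calc E.tildeNormOn (Ioo 0 u) w ≤ E.tildeNorm (fun t => (C * w u) * g (u / t)) := by
        refine E.tildeNorm_mono fun t ht => indicator_apply_le' (fun hut => ?_) (fun _ => zero_le)
        have : u / t ∈ Ioi (1 : ℝ) := (one_lt_div ht).2 hut.2
        rw [hg, indicator_of_mem this, Real.rpow_neg (by positivity),
          ← Real.inv_rpow (by positivity), inv_div]
        exact (h t u ht hut.2.le).trans (le_of_eq (by ring))
    _ = C * w u * E.tildeNorm g := by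
        rw [E.tildeNorm_const_mul _ (f := fun t => g (u / t))
          (hgm.comp (measurable_id.const_div _)).aemeasurable,
          E.tildeNorm_comp_div_left hgm.aemeasurable hu]
    _ = _ := by rw [ENNReal.coe_mul, ENNReal.coe_toNNReal hfin]; ring

theorem exists_le_mul_of_forall_mul_tildeNorm_le {m c : ℝ≥0∞} (hm : m ≠ 0) (hm' : m ≠ ∞)
    (hc : c ≠ 0) (hc' : c ≠ ∞) :
    ∃ C : ℝ≥0, 0 < C ∧ ∀ x y : ℝ≥0∞, c * x * m ≤ y → x ≤ C * y := by
  have hcm : c * m ≠ 0 := mul_ne_zero hc hm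
  have hcm' : c * m ≠ ∞ := ENNReal.mul_ne_top hc' hm'
  have hinv : (c * m)⁻¹ ≠ ∞ := ENNReal.inv_ne_top.2 hcm
  refine ⟨(c * m)⁻¹.toNNReal, ENNReal.toNNReal_pos (ENNReal.inv_ne_zero.2 hcm') hinv,
    fun x y h => ?_⟩
  rw [ENNReal.coe_toNNReal hinv]
  calc x = (c * m)⁻¹ * (c * x * m) := by
        rw [show c * x * m = c * m * x by ring, ← mul_assoc, ENNReal.inv_mul_cancel hcm hcm', one_mul]
    _ ≤ _ := by gcongr

/-- On (u, 2u) the weight cannot fall far below `w u`, `k` is at least `k u`, and the indicator of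
(u, 2u) has a norm independent of `u`. -/
theorem le_tildeNormOn_Ioi_of_lowerPower {α : ℝ} {w : ℝ → ℝ≥0∞} (hw : LowerPower α w) :
    ∃ C : ℝ≥0, 0 < C ∧ ∀ k : ℝ → ℝ≥0∞, Monotone k → ∀ u, 0 < u →
      w u * k u ≤ C * E.tildeNormOn (Ioi u) fun t => w t * k t := by
  obtain ⟨C, hC, h⟩ := hw
  -- The absolute value makes `2 ^ |α|` bound the power of the ratio on (1, 2) for either sign of
  -- `α`.
  set D : ℝ≥0∞ := C * ENNReal.ofReal (2 ^ |α|) with hD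
  have hD0 : D ≠ 0 := by
    have : (0 : ℝ) < 2 ^ |α| := by positivity
    simp [hD, hC.ne', this]
  have hD' : D ≠ ∞ := by finiteness
  obtain ⟨K, hK, hK'⟩ := exists_le_mul_of_forall_mul_tildeNorm_le E.tildeNorm_indicator_Ioo_ne_zero
    E.tildeNorm_indicator_Ioo_lt_top.ne (ENNReal.inv_ne_zero.2 hD') (ENNReal.inv_ne_top.2 hD0)
  have hχm : Measurable ((Ioo 1 2 : Set ℝ).indicator fun _ => (1 : ℝ≥0∞)) :=
    measurable_const.indicator measurableSet_Ioo
  refine ⟨K, hK, fun k hk u hu => hK' _ _ ?_⟩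
  rw [← E.tildeNorm_comp_div hχm.aemeasurable hu, ← E.tildeNorm_const_mul _
    (f := fun t => (Ioo 1 2 : Set ℝ).indicator (fun _ => (1 : ℝ≥0∞)) (t / u))
    (hχm.comp (measurable_id.div_const _)).aemeasurable]
  refine E.tildeNorm_mono fun t ht => ?_
  by_cases hmem : t / u ∈ Ioo (1 : ℝ) 2
  · have hut : u < t := (one_lt_div hu).1 hmem.1
    rw [indicator_of_mem hmem, mul_one, indicator_of_mem (show t ∈ Ioi u from hut)]
    have h1 : w u * k u ≤ D * (w t * k t) := by
      rw [← mul_assoc]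
      refine mul_le_mul' ((h u t hu hut.le).trans (mul_le_mul_left ?_ _)) (hk hut.le)
      rw [hD]
      refine mul_le_mul_right (ENNReal.ofReal_le_ofReal ?_) _
      calc (u / t) ^ α = (t / u) ^ (-α) := by
            rw [Real.rpow_neg (by positivity), ← Real.inv_rpow (by positivity), inv_div]
        _ ≤ (t / u) ^ |α| := Real.rpow_le_rpow_of_exponent_le hmem.1.le (neg_le_abs α)
        _ ≤ 2 ^ |α| := Real.rpow_le_rpow (by positivity) hmem.2.le (abs_nonneg α)
    calc D⁻¹ * (w u * k u) ≤ D⁻¹ * (D * (w t * k t)) := by gcongr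
      _ = w t * k t := by rw [← mul_assoc, ENNReal.inv_mul_cancel hD0 hD', one_mul]
  · rw [indicator_of_notMem hmem, mul_zero]
    exact zero_le

theorem le_tildeNormOn_Ioo_of_upperPower {α : ℝ} {w : ℝ → ℝ≥0∞} (hw : UpperPower α w) :
    ∃ C : ℝ≥0, 0 < C ∧ ∀ u, 0 < u → w u ≤ C * E.tildeNormOn (Ioo 0 u) w := by
  obtain ⟨C, hC, h⟩ := hw
  set D : ℝ≥0∞ := C * ENNReal.ofReal (2 ^ |α|) with hD
  have hD0 : D ≠ 0 := by
    have : (0 : ℝ) < 2 ^ |α| := by positivity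
    simp [hD, hC.ne', this]
  have hD' : D ≠ ∞ := by finiteness
  obtain ⟨K, hK, hK'⟩ := exists_le_mul_of_forall_mul_tildeNorm_le E.tildeNorm_indicator_Ioo_ne_zero
    E.tildeNorm_indicator_Ioo_lt_top.ne (ENNReal.inv_ne_zero.2 hD') (ENNReal.inv_ne_top.2 hD0)
  have hχm : Measurable ((Ioo 1 2 : Set ℝ).indicator fun _ => (1 : ℝ≥0∞)) :=
    measurable_const.indicator measurableSet_Ioo
  refine ⟨K, hK, fun u hu => hK' _ _ ?_⟩
  rw [← E.tildeNorm_comp_div_left hχm.aemeasurable hu, ← E.tildeNorm_const_mul _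
    (f := fun t => (Ioo 1 2 : Set ℝ).indicator (fun _ => (1 : ℝ≥0∞)) (u / t))
    (hχm.comp (measurable_id.const_div _)).aemeasurable]
  refine E.tildeNorm_mono fun t ht => ?_
  by_cases hmem : u / t ∈ Ioo (1 : ℝ) 2
  · have hut : t < u := (one_lt_div ht).1 hmem.1
    rw [indicator_of_mem hmem, mul_one, indicator_of_mem (show t ∈ Ioo 0 u from ⟨ht, hut⟩)]
    have h1 : w u ≤ D * w t := by
      refine (h t u ht hut.le).trans (mul_le_mul_left ?_ _)
      rw [hD]
      refine mul_le_mul_right (ENNReal.ofReal_le_ofReal ?_) _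
      calc (u / t) ^ α ≤ (u / t) ^ |α| := Real.rpow_le_rpow_of_exponent_le hmem.1.le (le_abs_self α)
        _ ≤ 2 ^ |α| := Real.rpow_le_rpow (by positivity) hmem.2.le (abs_nonneg α)
    calc D⁻¹ * w u ≤ D⁻¹ * (D * w t) := by gcongr
      _ = w t := by rw [← mul_assoc, ENNReal.inv_mul_cancel hD0 hD', one_mul]
  · rw [indicator_of_notMem hmem, mul_zero]
    exact zero_le

end RISpace

/-! ### The function u ↦ ‖b‖ over (0, u). -/

section HeadNorm

variable {E : RISpace} {b : ℝ → ℝ}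

theorem headNorm_mono (E : RISpace) (b : ℝ → ℝ) : Monotone (headNorm E b) := fun _ _ hst =>
  E.tildeNorm_mono fun _ _ => indicator_le_indicator_of_subset (Ioo_subset_Ioo_right hst)
    (fun _ => zero_le) _

theorem headNorm_lowerPower (E : RISpace) (b : ℝ → ℝ) : LowerPower 0 (headNorm E b) :=
  lowerPower_zero_of_monotone (headNorm_mono E b)

/-- The dilation by `s / t` maps (0, t) onto (0, s) and preserves the norm, while `b` changes under
it by at most a constant times `(t / s) ^ ε`. -/
theorem headNorm_upperPower (hb : SlowlyVarying b) {ε : ℝ} (hε : 0 < ε) :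
    UpperPower ε (headNorm E b) := by
  obtain ⟨C, hC, h⟩ := hb.upperPower hε
  refine ⟨C, hC, fun s t hs hst => ?_⟩
  have ht := hs.trans_le hst
  have hm := hb.aemeasurable_ofReal.indicator (measurableSet_Ioo (a := 0) (b := s))
  have hmp := measurePreserving_mul_homogeneousPos (div_pos hs ht)
  rw [headNorm, headNorm, RISpace.tildeNormOn, RISpace.tildeNormOn, ← E.tildeNorm_comp hmp hm,
    ← E.tildeNorm_const_mul _ (hm.comp_quasiMeasurePreserving hmp.quasiMeasurePreserving)]
  refine E.tildeNorm_mono fun r hr => indicator_apply_le' (fun hrt => ?_) (fun _ => zero_le)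
  have h1 : s / t * r ∈ Ioo 0 s := by
    refine ⟨by positivity, ?_⟩
    calc s / t * r < s / t * t := by gcongr; exact hrt.2
      _ = s := div_mul_cancel₀ _ ht.ne'
  have h2 : s / t * r ≤ r := by
    have : s / t ≤ 1 := (div_le_one ht).2 hst
    nlinarith
  rw [Function.comp_apply, indicator_of_mem h1]
  have h3 := h _ r h1.1 h2
  rwa [show r / (s / t * r) = t / s by field_simp] at h3

theorem headNorm_ne_top (hb : SlowlyVarying b) (h1 : headNorm E b 1 < ∞) (u : ℝ) :
    headNorm E b u ≠ ∞ := by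
  rcases le_total u 1 with hu | hu
  · exact ((headNorm_mono E b hu).trans_lt h1).ne
  · obtain ⟨C, _, h⟩ := headNorm_upperPower (E := E) hb one_pos
    exact ((h 1 u one_pos hu).trans_lt (by finiteness)).ne

/-- The part of the norm over (u/2, u) already dominates `b u`. This lets a stray value of `b` be
absorbed into the factor that occurs in ρ. -/
theorem le_headNorm (E : RISpace) (hb : SlowlyVarying b) :
    ∃ C : ℝ≥0, 0 < C ∧ ∀ u, 0 < u → ENNReal.ofReal (b u) ≤ C * headNorm E b u :=
  E.le_tildeNormOn_Ioo_of_upperPower (hb.upperPower one_pos)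

theorem headNorm_ne_zero (hb : SlowlyVarying b) {u : ℝ} (hu : 0 < u) : headNorm E b u ≠ 0 := by
  obtain ⟨C, _, h⟩ := le_headNorm E hb
  intro h0
  have := h u hu
  rw [h0, mul_zero, nonpos_iff_eq_zero] at this
  exact hb.ofReal_ne_zero hu this

end HeadNorm

/-! ### The weights s^(-θ) a(s). -/

section PowerWeight

/-- The weight `s ↦ s ^ (-θ) a(s)` with values in `[0, ∞]`. -/
def powerWeight (θ : ℝ) (a : ℝ → ℝ) (s : ℝ) : ℝ≥0∞ :=
  ENNReal.ofReal (s ^ (-θ) * a s)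

variable {θ : ℝ} {a : ℝ → ℝ}

theorem powerWeight_eq (θ : ℝ) (a : ℝ → ℝ) {s : ℝ} (hs : 0 < s) :
    powerWeight θ a s = ENNReal.ofReal (s ^ (-θ)) * ENNReal.ofReal (a s) :=
  ENNReal.ofReal_mul (by positivity)

theorem powerWeight_ne_zero (ha : SlowlyVarying a) {s : ℝ} (hs : 0 < s) :
    powerWeight θ a s ≠ 0 := by
  have := ha.pos s hs
  have : 0 < s ^ (-θ) * a s := by positivity
  simpa [powerWeight] using this

theorem powerWeight_ne_top (s : ℝ) : powerWeight θ a s ≠ ∞ := ENNReal.ofReal_ne_top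

theorem powerWeight_aemeasurable (ha : SlowlyVarying a) :
    AEMeasurable (powerWeight θ a) homogeneousPos := by
  have h1 : AEMeasurable (fun s : ℝ => s ^ (-θ)) homogeneousPos := by fun_prop
  exact (h1.mul (ha.aemeasurable.mono_ac homogeneousPos_absolutelyContinuous)).ennreal_ofReal

theorem aemeasurable_powerWeight_mul (ha : SlowlyVarying a) {k : ℝ → ℝ≥0∞} (hk : Monotone k) :
    AEMeasurable (fun s => powerWeight θ a s * k s) homogeneousPos :=
  (powerWeight_aemeasurable ha).mul hk.measurable.aemeasurable

theorem UpperPower.congr {α : ℝ} {v w : ℝ → ℝ≥0∞} (hv : UpperPower α v)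
    (h : ∀ t, 0 < t → w t = v t) : UpperPower α w := by
  obtain ⟨C, hC, hv⟩ := hv
  refine ⟨C, hC, fun s t hs hst => ?_⟩
  rw [h s hs, h t (hs.trans_le hst)]
  exact hv s t hs hst

theorem LowerPower.congr {α : ℝ} {v w : ℝ → ℝ≥0∞} (hv : LowerPower α v)
    (h : ∀ t, 0 < t → w t = v t) : LowerPower α w := by
  obtain ⟨C, hC, hv⟩ := hv
  refine ⟨C, hC, fun s t hs hst => ?_⟩
  rw [h s hs, h t (hs.trans_le hst)]
  exact hv s t hs hst

theorem powerWeight_upperPower (ha : SlowlyVarying a) {α : ℝ} (hα : -θ < α) :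
    UpperPower α (powerWeight θ a) := by
  have h := (upperPower_rpow (-θ)).mul (ha.upperPower (sub_pos.2 hα))
  rw [add_sub_cancel] at h
  exact h.congr fun t ht => powerWeight_eq θ a ht

theorem powerWeight_lowerPower (ha : SlowlyVarying a) {α : ℝ} (hα : α < -θ) :
    LowerPower α (powerWeight θ a) := by
  have h := (lowerPower_rpow (-θ)).mul (ha.lowerPower (sub_pos.2 hα))
  rw [show -θ + -(-θ - α) = α by ring] at h
  exact h.congr fun t ht => powerWeight_eq θ a ht

end PowerWeight

/-! ### Iterated norms of monotone functions. -/

section NestedNorm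

/-- The norm in `Ẽ(R)` of `t ↦ b(t) ‖s ^ (-θ) a(s) k(s)‖_{F̃(S t)}`. -/
def nestedNorm (θ : ℝ) (b : ℝ → ℝ) (E : RISpace) (a : ℝ → ℝ) (F : RISpace) (R : Set ℝ)
    (S : ℝ → Set ℝ) (k : ℝ → ℝ≥0∞) : ℝ≥0∞ :=
  E.tildeNormOn R fun t =>
    ENNReal.ofReal (b t) * F.tildeNormOn (S t) fun s => powerWeight θ a s * k s

variable {θ : ℝ} {a b : ℝ → ℝ} {E F : RISpace} {R : Set ℝ} {S : ℝ → Set ℝ} {k k₀ k₁ : ℝ → ℝ≥0∞}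

theorem RISpace.tildeNormOn_univ (E : RISpace) (f : ℝ → ℝ≥0∞) :
    E.tildeNormOn univ f = E.tildeNorm f := by
  rw [RISpace.tildeNormOn, indicator_univ]

theorem RISpace.measurable_tildeNormOn_of_antitone (F : RISpace) (hS : Antitone S)
    (f : ℝ → ℝ≥0∞) : Measurable fun t => F.tildeNormOn (S t) f :=
  Antitone.measurable fun _ _ hst => F.tildeNorm_mono fun _ _ =>
    indicator_le_indicator_of_subset (hS hst) (fun _ => zero_le) _

theorem antitone_Ioi_real : Antitone (Ioi : ℝ → Set ℝ) := fun _ _ h => Ioi_subset_Ioi h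

theorem antitone_Ioo_real (u : ℝ) : Antitone fun t : ℝ => Ioo t u := fun _ _ h =>
  Ioo_subset_Ioo_left h

theorem aemeasurable_nested (hb : SlowlyVarying b) (F : RISpace) (hS : Antitone S)
    (f : ℝ → ℝ≥0∞) :
    AEMeasurable (fun t => ENNReal.ofReal (b t) * F.tildeNormOn (S t) f) homogeneousPos :=
  hb.aemeasurable_ofReal.mul (F.measurable_tildeNormOn_of_antitone hS f).aemeasurable

theorem tildeNormOn_le_of_le_mul_add (ha : SlowlyVarying a) (F : RISpace) {S : Set ℝ}
    (hS : MeasurableSet S) (hk₀ : Monotone k₀) (hk₁ : Monotone k₁) {κ : ℝ≥0∞}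
    (h : ∀ s, 0 < s → k s ≤ κ * (k₀ s + k₁ s)) :
    F.tildeNormOn S (fun s => powerWeight θ a s * k s) ≤
      κ * (F.tildeNormOn S (fun s => powerWeight θ a s * k₀ s) +
        F.tildeNormOn S (fun s => powerWeight θ a s * k₁ s)) := by
  have h0 := aemeasurable_powerWeight_mul (θ := θ) ha hk₀
  have h1 := aemeasurable_powerWeight_mul (θ := θ) ha hk₁
  calc F.tildeNormOn S (fun s => powerWeight θ a s * k s)
      ≤ F.tildeNormOn S (fun s => κ * (powerWeight θ a s * k₀ s + powerWeight θ a s * k₁ s)) := by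
        refine F.tildeNormOn_mono 0 (fun _ h _ _ => h) fun s _ hs _ => ?_
        calc powerWeight θ a s * k s ≤ powerWeight θ a s * (κ * (k₀ s + k₁ s)) := by
              gcongr; exact h s hs
          _ = _ := by ring
    _ = κ * F.tildeNormOn S (fun s => powerWeight θ a s * k₀ s + powerWeight θ a s * k₁ s) :=
        F.tildeNormOn_const_mul κ hS (h0.add h1)
    _ ≤ _ := by gcongr; exact F.tildeNormOn_add_le hS h0 h1

theorem nestedNorm_le_of_le_mul_add (ha : SlowlyVarying a) (hb : SlowlyVarying b)
    (hR : MeasurableSet R) (hS : ∀ t, MeasurableSet (S t)) (hS' : Antitone S)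
    (hk₀ : Monotone k₀) (hk₁ : Monotone k₁) {κ : ℝ≥0∞}
    (h : ∀ s, 0 < s → k s ≤ κ * (k₀ s + k₁ s)) :
    nestedNorm θ b E a F R S k ≤
      κ * (nestedNorm θ b E a F R S k₀ + nestedNorm θ b E a F R S k₁) := by
  have h0 := aemeasurable_nested hb F hS' fun s => powerWeight θ a s * k₀ s
  have h1 := aemeasurable_nested hb F hS' fun s => powerWeight θ a s * k₁ s
  refine le_trans (E.tildeNormOn_mono 0 (T := R) (fun _ h _ _ => h)
    (g := fun t => κ * (ENNReal.ofReal (b t) * F.tildeNormOn (S t) (fun s => powerWeight θ a s * k₀ s)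
      + ENNReal.ofReal (b t) * F.tildeNormOn (S t) (fun s => powerWeight θ a s * k₁ s)))
    fun t _ _ _ => ?_) ?_
  · calc _ ≤ ENNReal.ofReal (b t) * (κ * (F.tildeNormOn (S t) (fun s => powerWeight θ a s * k₀ s) +
        F.tildeNormOn (S t) (fun s => powerWeight θ a s * k₁ s))) := by
          gcongr
          exact tildeNormOn_le_of_le_mul_add ha F (hS t) hk₀ hk₁ h
      _ = _ := by ring
  · refine (E.tildeNormOn_const_mul κ hR (h0.add h1)).trans_le ?_
    gcongr
    exact E.tildeNormOn_add_le hR h0 h1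

theorem nestedNorm_mono {R' : Set ℝ} {S' : ℝ → Set ℝ} (hR : R ⊆ R') (hS : ∀ t ∈ R, S t ⊆ S' t) :
    nestedNorm θ b E a F R S k ≤ nestedNorm θ b E a F R' S' k := by
  refine E.tildeNormOn_mono 0 (fun _ h _ _ => hR h) fun t ht _ _ => ?_
  gcongr
  exact F.tildeNormOn_mono 0 (fun _ h _ _ => hS t ht h) fun _ _ _ _ => le_rfl

/-- For `t < u` the inner norm over (t, ∞) is at least the one over (u, ∞), which does not depend on
`t`. -/
theorem headNorm_mul_tail_le (hb : SlowlyVarying b) (u : ℝ) :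
    headNorm E b u * F.tildeNormOn (Ioi u) (fun s => powerWeight θ a s * k s) ≤
      nestedNorm θ b E a F univ Ioi k := by
  rw [mul_comm, headNorm, ← E.tildeNormOn_const_mul _ measurableSet_Ioo hb.aemeasurable_ofReal]
  refine E.tildeNormOn_mono 0 (fun _ _ _ _ => mem_univ _) fun t ht _ _ => ?_
  rw [mul_comm]
  gcongr
  exact F.tildeNormOn_mono 0 (fun _ h _ _ => Ioi_subset_Ioi ht.2.le h) fun _ _ _ _ => le_rfl

theorem exists_mul_le_tail (ha : SlowlyVarying a) (θ : ℝ) (F : RISpace) :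
    ∃ C : ℝ≥0, 0 < C ∧ ∀ k : ℝ → ℝ≥0∞, Monotone k → ∀ u, 0 < u →
      powerWeight θ a u * k u ≤ C * F.tildeNormOn (Ioi u) fun s => powerWeight θ a s * k s :=
  F.le_tildeNormOn_Ioi_of_lowerPower (powerWeight_lowerPower ha (sub_one_lt (-θ)))

theorem exists_mul_headNorm_mul_le (ha : SlowlyVarying a) (hb : SlowlyVarying b) (θ : ℝ)
    (E F : RISpace) :
    ∃ C : ℝ≥0, ∀ k : ℝ → ℝ≥0∞, Monotone k → ∀ u, 0 < u →
      powerWeight θ a u * headNorm E b u * k u ≤ C * nestedNorm θ b E a F univ Ioi k := by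
  obtain ⟨C, _, h⟩ := exists_mul_le_tail ha θ F
  refine ⟨C, fun k hk u hu => ?_⟩
  calc _ = headNorm E b u * (powerWeight θ a u * k u) := by ring
    _ ≤ headNorm E b u * (C * F.tildeNormOn (Ioi u) fun s => powerWeight θ a s * k s) := by
        exact mul_le_mul_right (h k hk u hu) _
    _ = C * (headNorm E b u * F.tildeNormOn (Ioi u) fun s => powerWeight θ a s * k s) := by ring
    _ ≤ _ := by gcongr; exact headNorm_mul_tail_le hb u

end NestedNorm

/-! ### ρ as a quotient of the two weights. -/

section Rho

variable {θ₀ θ₁ : ℝ} {a₀ a₁ b₀ b₁ : ℝ → ℝ} {E₀ E₁ F₀ F₁ : RISpace}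

theorem powerWeight_mul_headNorm_ne_zero {E : RISpace} {a b : ℝ → ℝ} {θ : ℝ}
    (ha : SlowlyVarying a) (hb : SlowlyVarying b) {u : ℝ} (hu : 0 < u) :
    powerWeight θ a u * headNorm E b u ≠ 0 :=
  mul_ne_zero (powerWeight_ne_zero ha hu) (headNorm_ne_zero hb hu)

theorem powerWeight_mul_headNorm_ne_top {E : RISpace} {a b : ℝ → ℝ} {θ : ℝ}
    (hb : SlowlyVarying b) (hE : headNorm E b 1 < ∞) (u : ℝ) :
    powerWeight θ a u * headNorm E b u ≠ ∞ :=
  ENNReal.mul_ne_top (powerWeight_ne_top u) (headNorm_ne_top hb hE u)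

theorem rhoRR_mul (ha₁ : SlowlyVarying a₁) (hb₁ : SlowlyVarying b₁) (hE₁ : headNorm E₁ b₁ 1 < ∞)
    {u : ℝ} (hu : 0 < u) :
    rhoRR θ₀ θ₁ a₀ a₁ b₀ b₁ E₀ E₁ u * (powerWeight θ₁ a₁ u * headNorm E₁ b₁ u) =
      powerWeight θ₀ a₀ u * headNorm E₀ b₀ u := by
  have h1 : ENNReal.ofReal (a₁ u) * headNorm E₁ b₁ u ≠ 0 :=
    mul_ne_zero (ha₁.ofReal_ne_zero hu) (headNorm_ne_zero hb₁ hu)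
  have h2 : ENNReal.ofReal (a₁ u) * headNorm E₁ b₁ u ≠ ∞ :=
    ENNReal.mul_ne_top ENNReal.ofReal_ne_top (headNorm_ne_top hb₁ hE₁ u)
  have h3 : ENNReal.ofReal (u ^ (θ₁ - θ₀)) * ENNReal.ofReal (u ^ (-θ₁)) =
      ENNReal.ofReal (u ^ (-θ₀)) := by
    rw [← ENNReal.ofReal_mul (by positivity), ← Real.rpow_add hu]; congr 2; ring
  rw [powerWeight_eq _ _ hu, powerWeight_eq _ _ hu, ← h3, rhoRR]
  calc _ = ENNReal.ofReal (u ^ (θ₁ - θ₀)) * ENNReal.ofReal (u ^ (-θ₁)) *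
        (ENNReal.ofReal (a₀ u) * headNorm E₀ b₀ u / (ENNReal.ofReal (a₁ u) * headNorm E₁ b₁ u) *
          (ENNReal.ofReal (a₁ u) * headNorm E₁ b₁ u)) := by ring
    _ = _ := by rw [ENNReal.div_mul_cancel h1 h2]; ring

theorem rhoRR_eq (ha₁ : SlowlyVarying a₁) (hb₁ : SlowlyVarying b₁) (hE₁ : headNorm E₁ b₁ 1 < ∞)
    {u : ℝ} (hu : 0 < u) :
    rhoRR θ₀ θ₁ a₀ a₁ b₀ b₁ E₀ E₁ u =
      powerWeight θ₀ a₀ u * headNorm E₀ b₀ u * (powerWeight θ₁ a₁ u * headNorm E₁ b₁ u)⁻¹ := by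
  rw [← rhoRR_mul ha₁ hb₁ hE₁ hu, mul_assoc, ENNReal.mul_inv_cancel
    (powerWeight_mul_headNorm_ne_zero ha₁ hb₁ hu) (powerWeight_mul_headNorm_ne_top hb₁ hE₁ u),
    mul_one]

end Rho

/-! ### The crossed terms in the lower bound for the K-functional. -/

section LowerEstimate

variable {θ₀ θ₁ : ℝ} {a₀ a₁ b₀ b₁ : ℝ → ℝ} {E₀ E₁ F₀ F₁ : RISpace}

theorem mul_le_mul_mul_inv_of_mul_le {w p x y : ℝ≥0∞} (hp : p ≠ 0) (hp' : p ≠ ∞) (h : p * x ≤ y) :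
    w * x ≤ y * (w * p⁻¹) := by
  calc w * x = (p * x) * (w * p⁻¹) := by
        rw [show p * x * (w * p⁻¹) = w * x * (p * p⁻¹) by ring, ENNReal.mul_inv_cancel hp hp', mul_one]
    _ ≤ _ := by gcongr

theorem aemeasurable_quotient {a a' b' : ℝ → ℝ} {θ θ' : ℝ} {E' : RISpace} (ha : SlowlyVarying a)
    (ha' : SlowlyVarying a') :
    AEMeasurable (fun t => powerWeight θ a t * (powerWeight θ' a' t * headNorm E' b' t)⁻¹)
      homogeneousPos :=
  (powerWeight_aemeasurable ha).mul
    ((powerWeight_aemeasurable ha').mul (headNorm_mono E' b').measurable.aemeasurable).inv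

theorem upperPower_quotient (ha₀ : SlowlyVarying a₀) (ha₁ : SlowlyVarying a₁)
    {δ : ℝ} (hδ : δ < θ₁ - θ₀) :
    UpperPower (-δ) (fun t => powerWeight θ₁ a₁ t * (powerWeight θ₀ a₀ t * headNorm E₀ b₀ t)⁻¹) := by
  -- Two losses of `ε`, from `a₁` and `a₀`; the head norm is monotone and costs nothing as a lower
  -- power.
  set ε := (θ₁ - θ₀ - δ) / 2 with hε
  have h0 := powerWeight_lowerPower ha₀ (show -θ₀ - ε < -θ₀ by linarith)
  have h1 := powerWeight_upperPower ha₁ (show -θ₁ < -θ₁ + ε by linarith)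
  have h := h1.mul (h0.mul (headNorm_lowerPower E₀ b₀)).inv
  rwa [show -θ₁ + ε + -(-θ₀ - ε + 0) = -δ by rw [hε]; ring] at h

theorem lowerPower_quotient (ha₀ : SlowlyVarying a₀) (ha₁ : SlowlyVarying a₁)
    (hb₁ : SlowlyVarying b₁) {δ : ℝ} (hδ : δ < θ₁ - θ₀) :
    LowerPower δ (fun t => powerWeight θ₀ a₀ t * (powerWeight θ₁ a₁ t * headNorm E₁ b₁ t)⁻¹) := by
  -- Here the head norm stands in the denominator and needs an upper power, which is a third loss of
  -- `ε`.
  set ε := (θ₁ - θ₀ - δ) / 3 with hε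
  have hε0 : 0 < ε := by rw [hε]; linarith
  have h0 := powerWeight_lowerPower ha₀ (show -θ₀ - ε < -θ₀ by linarith)
  have h1 := powerWeight_upperPower ha₁ (show -θ₁ < -θ₁ + ε by linarith)
  have h := h0.mul (h1.mul (headNorm_upperPower (E := E₁) hb₁ hε0)).inv
  rwa [show -θ₀ - ε + -(-θ₁ + ε + ε) = δ by rw [hε]; ring] at h

/-- The pointwise bound by the norm in Y_0 leaves the quotient of the weights, a decaying power,
whose tail norm is controlled by its value at `u`. -/
theorem exists_tail_le (hθ : θ₀ < θ₁) (ha₀ : SlowlyVarying a₀) (ha₁ : SlowlyVarying a₁)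
    (hb₀ : SlowlyVarying b₀) (hE₀ : headNorm E₀ b₀ 1 < ∞) (F₀ F₁ : RISpace) :
    ∃ C : ℝ≥0, ∀ k : ℝ → ℝ≥0∞, Monotone k → ∀ u, 0 < u →
      F₁.tildeNormOn (Ioi u) (fun s => powerWeight θ₁ a₁ s * k s) ≤
        C * nestedNorm θ₀ b₀ E₀ a₀ F₀ univ Ioi k *
          (powerWeight θ₁ a₁ u * (powerWeight θ₀ a₀ u * headNorm E₀ b₀ u)⁻¹) := by
  obtain ⟨C, hC⟩ := exists_mul_headNorm_mul_le ha₀ hb₀ θ₀ E₀ F₀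
  obtain ⟨D, hD⟩ := F₁.tildeNormOn_Ioi_le_of_upperPower (half_pos (sub_pos.2 hθ))
    (upperPower_quotient (E₀ := E₀) (b₀ := b₀) ha₀ ha₁ (half_lt_self (sub_pos.2 hθ)))
  refine ⟨C * D, fun k hk u hu => ?_⟩
  set N := nestedNorm θ₀ b₀ E₀ a₀ F₀ univ Ioi k
  calc _ ≤ F₁.tildeNormOn (Ioi u) (fun s => C * N *
        (powerWeight θ₁ a₁ s * (powerWeight θ₀ a₀ s * headNorm E₀ b₀ s)⁻¹)) := by
        refine F₁.tildeNormOn_mono 0 (fun _ h _ _ => h) fun s _ hs _ => ?_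
        exact mul_le_mul_mul_inv_of_mul_le (powerWeight_mul_headNorm_ne_zero ha₀ hb₀ hs)
          (powerWeight_mul_headNorm_ne_top hb₀ hE₀ s) (hC k hk s hs)
    _ ≤ C * N * (D * (powerWeight θ₁ a₁ u * (powerWeight θ₀ a₀ u * headNorm E₀ b₀ u)⁻¹)) := by
        rw [F₁.tildeNormOn_const_mul _ measurableSet_Ioi (aemeasurable_quotient ha₁ ha₀)]
        gcongr
        exact hD u hu
    _ = _ := by rw [ENNReal.coe_mul]; ring

theorem rhoRR_mul_headNorm_mul (ha₀ : SlowlyVarying a₀) (ha₁ : SlowlyVarying a₁)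
    (hb₀ : SlowlyVarying b₀) (hb₁ : SlowlyVarying b₁)
    (hE₀ : headNorm E₀ b₀ 1 < ∞) (hE₁ : headNorm E₁ b₁ 1 < ∞) {u : ℝ} (hu : 0 < u) :
    rhoRR θ₀ θ₁ a₀ a₁ b₀ b₁ E₀ E₁ u * (headNorm E₁ b₁ u *
      (powerWeight θ₁ a₁ u * (powerWeight θ₀ a₀ u * headNorm E₀ b₀ u)⁻¹)) = 1 := by
  calc _ = rhoRR θ₀ θ₁ a₀ a₁ b₀ b₁ E₀ E₁ u * (powerWeight θ₁ a₁ u * headNorm E₁ b₁ u) *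
        (powerWeight θ₀ a₀ u * headNorm E₀ b₀ u)⁻¹ := by ring
    _ = 1 := by
        rw [rhoRR_mul ha₁ hb₁ hE₁ hu]
        exact ENNReal.mul_inv_cancel (powerWeight_mul_headNorm_ne_zero ha₀ hb₀ hu)
          (powerWeight_mul_headNorm_ne_top hb₀ hE₀ u)

theorem exists_middle_term_le (hθ : θ₀ < θ₁) (ha₀ : SlowlyVarying a₀) (ha₁ : SlowlyVarying a₁)
    (hb₀ : SlowlyVarying b₀) (hb₁ : SlowlyVarying b₁)
    (hE₀ : headNorm E₀ b₀ 1 < ∞) (hE₁ : headNorm E₁ b₁ 1 < ∞) (F₀ F₁ : RISpace) :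
    ∃ C : ℝ≥0, ∀ k : ℝ → ℝ≥0∞, Monotone k → ∀ u, 0 < u →
      rhoRR θ₀ θ₁ a₀ a₁ b₀ b₁ E₀ E₁ u * (headNorm E₁ b₁ u *
        F₁.tildeNormOn (Ioi u) (fun s => powerWeight θ₁ a₁ s * k s)) ≤
      C * nestedNorm θ₀ b₀ E₀ a₀ F₀ univ Ioi k := by
  obtain ⟨C, hC⟩ := exists_tail_le hθ ha₀ ha₁ hb₀ hE₀ F₀ F₁
  refine ⟨C, fun k hk u hu => ?_⟩
  set N := nestedNorm θ₀ b₀ E₀ a₀ F₀ univ Ioi k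
  calc _ ≤ rhoRR θ₀ θ₁ a₀ a₁ b₀ b₁ E₀ E₁ u * (headNorm E₁ b₁ u * (C * N *
        (powerWeight θ₁ a₁ u * (powerWeight θ₀ a₀ u * headNorm E₀ b₀ u)⁻¹))) := by
        gcongr; exact hC k hk u hu
    _ = C * N * (rhoRR θ₀ θ₁ a₀ a₁ b₀ b₁ E₀ E₁ u * (headNorm E₁ b₁ u *
        (powerWeight θ₁ a₁ u * (powerWeight θ₀ a₀ u * headNorm E₀ b₀ u)⁻¹))) := by ring
    _ = C * N := by rw [rhoRR_mul_headNorm_mul ha₀ ha₁ hb₀ hb₁ hE₀ hE₁ hu, mul_one]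

theorem exists_outer_term_le (hθ : θ₀ < θ₁) (ha₀ : SlowlyVarying a₀) (ha₁ : SlowlyVarying a₁)
    (hb₀ : SlowlyVarying b₀) (hb₁ : SlowlyVarying b₁)
    (hE₀ : headNorm E₀ b₀ 1 < ∞) (hE₁ : headNorm E₁ b₁ 1 < ∞) (F₀ F₁ : RISpace) :
    ∃ C : ℝ≥0, ∀ k : ℝ → ℝ≥0∞, Monotone k → ∀ u, 0 < u →
      rhoRR θ₀ θ₁ a₀ a₁ b₀ b₁ E₀ E₁ u * nestedNorm θ₁ b₁ E₁ a₁ F₁ (Ioi u) Ioi k ≤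
      C * nestedNorm θ₀ b₀ E₀ a₀ F₀ univ Ioi k := by
  obtain ⟨C, hC⟩ := exists_tail_le hθ ha₀ ha₁ hb₀ hE₀ F₀ F₁
  have hη : 0 < (θ₁ - θ₀) / 3 := by linarith
  -- The quotient gives decay of two thirds of `θ₁ - θ₀`; `b₁` costs one third, and one third
  -- remains.
  have hbQ := (hb₁.upperPower hη).mul (upperPower_quotient (E₀ := E₀) (b₀ := b₀) ha₀ ha₁
    (show 2 * ((θ₁ - θ₀) / 3) < θ₁ - θ₀ by linarith))
  rw [show (θ₁ - θ₀) / 3 + -(2 * ((θ₁ - θ₀) / 3)) = -((θ₁ - θ₀) / 3) by ring] at hbQ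
  obtain ⟨D, hD⟩ := E₁.tildeNormOn_Ioi_le_of_upperPower hη hbQ
  obtain ⟨G, _, hG⟩ := le_headNorm E₁ hb₁
  refine ⟨C * D * G, fun k hk u hu => ?_⟩
  set N := nestedNorm θ₀ b₀ E₀ a₀ F₀ univ Ioi k
  set Q : ℝ → ℝ≥0∞ := fun t =>
    powerWeight θ₁ a₁ t * (powerWeight θ₀ a₀ t * headNorm E₀ b₀ t)⁻¹ with hQ
  have h1 : nestedNorm θ₁ b₁ E₁ a₁ F₁ (Ioi u) Ioi k ≤ C * N * (D * (G * headNorm E₁ b₁ u * Q u)) := by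
    calc _ ≤ E₁.tildeNormOn (Ioi u) (fun t => C * N * (ENNReal.ofReal (b₁ t) * Q t)) := by
          refine E₁.tildeNormOn_mono 0 (fun _ h _ _ => h) fun t _ ht _ => ?_
          calc _ ≤ ENNReal.ofReal (b₁ t) * (C * N * Q t) := by gcongr; exact hC k hk t ht
            _ = _ := by ring
      _ = C * N * E₁.tildeNormOn (Ioi u) (fun t => ENNReal.ofReal (b₁ t) * Q t) :=
          E₁.tildeNormOn_const_mul _ measurableSet_Ioi
            (hb₁.aemeasurable_ofReal.mul (aemeasurable_quotient ha₁ ha₀))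
      _ ≤ C * N * (D * (ENNReal.ofReal (b₁ u) * Q u)) := by gcongr; exact hD u hu
      _ ≤ _ := by gcongr; exact hG u hu
  calc _ ≤ rhoRR θ₀ θ₁ a₀ a₁ b₀ b₁ E₀ E₁ u * (C * N * (D * (G * headNorm E₁ b₁ u * Q u))) := by
        gcongr
    _ = C * D * G * N * (rhoRR θ₀ θ₁ a₀ a₁ b₀ b₁ E₀ E₁ u * (headNorm E₁ b₁ u * Q u)) := by ring
    _ = _ := by
        rw [hQ, rhoRR_mul_headNorm_mul ha₀ ha₁ hb₀ hb₁ hE₀ hE₁ hu, mul_one]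
        push_cast; ring

theorem exists_inner_term_le (hθ : θ₀ < θ₁) (ha₀ : SlowlyVarying a₀) (ha₁ : SlowlyVarying a₁)
    (hb₀ : SlowlyVarying b₀) (hb₁ : SlowlyVarying b₁) (hE₁ : headNorm E₁ b₁ 1 < ∞)
    (E₀ F₀ F₁ : RISpace) :
    ∃ C : ℝ≥0, ∀ k : ℝ → ℝ≥0∞, Monotone k → ∀ u, 0 < u →
      nestedNorm θ₀ b₀ E₀ a₀ F₀ (Ioo 0 u) (fun t => Ioo t u) k ≤
      C * (rhoRR θ₀ θ₁ a₀ a₁ b₀ b₁ E₀ E₁ u * nestedNorm θ₁ b₁ E₁ a₁ F₁ univ Ioi k) := by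
  obtain ⟨C, hC⟩ := exists_mul_headNorm_mul_le ha₁ hb₁ θ₁ E₁ F₁
  obtain ⟨D, hD⟩ := F₀.tildeNormOn_Ioo_le_of_lowerPower (half_pos (sub_pos.2 hθ))
    (lowerPower_quotient (E₁ := E₁) ha₀ ha₁ hb₁ (half_lt_self (sub_pos.2 hθ)))
  refine ⟨C * D, fun k hk u hu => ?_⟩
  set N := nestedNorm θ₁ b₁ E₁ a₁ F₁ univ Ioi k
  set Q : ℝ → ℝ≥0∞ := fun t =>
    powerWeight θ₀ a₀ t * (powerWeight θ₁ a₁ t * headNorm E₁ b₁ t)⁻¹ with hQ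
  have h1 : ∀ t, 0 < t →
      F₀.tildeNormOn (Ioo t u) (fun s => powerWeight θ₀ a₀ s * k s) ≤ C * N * (D * Q u) := by
    intro t ht
    calc _ ≤ F₀.tildeNormOn (Ioo 0 u) (fun s => C * N * Q s) := by
          -- Enlarging (t, u) to (0, u) makes the bound independent of `t`, so the outer norm only
          -- contributes the head norm of `b₀`.
          refine F₀.tildeNormOn_mono 0 (fun s h hs _ => ⟨hs, h.2⟩) fun s _ hs _ => ?_
          exact mul_le_mul_mul_inv_of_mul_le (powerWeight_mul_headNorm_ne_zero ha₁ hb₁ hs)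
            (powerWeight_mul_headNorm_ne_top hb₁ hE₁ s) (hC k hk s hs)
      _ ≤ _ := by
          rw [F₀.tildeNormOn_const_mul _ measurableSet_Ioo (aemeasurable_quotient ha₀ ha₁)]
          gcongr
          exact hD u hu
  calc _ ≤ E₀.tildeNormOn (Ioo 0 u) (fun t => C * N * (D * Q u) * ENNReal.ofReal (b₀ t)) := by
        refine E₀.tildeNormOn_mono 0 (fun _ h _ _ => h) fun t _ ht _ => ?_
        rw [mul_comm]
        gcongr
        exact h1 t ht
    _ = C * N * (D * Q u) * headNorm E₀ b₀ u :=
        E₀.tildeNormOn_const_mul _ measurableSet_Ioo hb₀.aemeasurable_ofReal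
    _ = _ := by rw [rhoRR_eq ha₁ hb₁ hE₁ hu, hQ]; push_cast; ring

end LowerEstimate

/-! ### Norms of the two parts of a decomposition. -/

section UpperEstimate

variable {θ : ℝ} {a b : ℝ → ℝ}

/-- Meant for `k₀ = K(·, f₀)`. Below `u` the comparison with `k` gives the truncated norm; beyond
`u` only the constant bound is used, and the weight decays because `θ > 0`. -/
theorem exists_nestedNorm_le_of_le_const (hθ : 0 < θ) (ha : SlowlyVarying a) (hb : SlowlyVarying b)
    (E F : RISpace) :
    ∃ C : ℝ≥0, ∀ (D : ℝ≥0) (c : ℝ≥0∞) (k k₀ : ℝ → ℝ≥0∞), Monotone k → Monotone k₀ → ∀ u, 0 < u →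
      (∀ s, 0 < s → k₀ s ≤ c) → (∀ s, 0 < s → s ≤ u → k₀ s ≤ D * k s) →
      nestedNorm θ b E a F univ Ioi k₀ ≤
        D * nestedNorm θ b E a F (Ioo 0 u) (fun t => Ioo t u) k +
          C * (powerWeight θ a u * headNorm E b u * c) := by
  have hW := powerWeight_upperPower (θ := θ) ha (show -θ < -(θ / 2) by linarith)
  obtain ⟨C₁, h₁⟩ := F.tildeNormOn_Ioi_le_of_upperPower (half_pos hθ) hW
  have hbW := (hb.upperPower (show 0 < θ / 4 by linarith)).mul hW
  rw [show θ / 4 + -(θ / 2) = -(θ / 4) by ring] at hbW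
  obtain ⟨C₂, h₂⟩ := E.tildeNormOn_Ioi_le_of_upperPower (show 0 < θ / 4 by linarith) hbW
  obtain ⟨C₃, _, h₃⟩ := le_headNorm E hb
  refine ⟨C₁ + C₁ * C₂ * C₃, fun D c k k₀ hk hk₀ u hu hc hD => ?_⟩
  have hWm := powerWeight_aemeasurable (θ := θ) ha
  have htail : ∀ t, 0 < t →
      F.tildeNormOn (Ioi t) (fun s => powerWeight θ a s * k₀ s) ≤ c * (C₁ * powerWeight θ a t) := by
    intro t ht
    calc _ ≤ F.tildeNormOn (Ioi t) (fun s => c * powerWeight θ a s) := by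
          refine F.tildeNormOn_mono 0 (fun _ h _ _ => h) fun s _ hs _ => ?_
          rw [mul_comm]
          gcongr
          exact hc s hs
      _ ≤ _ := by
          rw [F.tildeNormOn_const_mul _ measurableSet_Ioi hWm]
          gcongr
          exact h₁ t ht
  have hinner : nestedNorm θ b E a F (Ioo 0 u) Ioi k₀ ≤
      D * nestedNorm θ b E a F (Ioo 0 u) (fun t => Ioo t u) k +
        c * (C₁ * powerWeight θ a u) * headNorm E b u := by
    have hm := aemeasurable_nested hb F (antitone_Ioo_real u) fun s => powerWeight θ a s * k s
    calc _ ≤ E.tildeNormOn (Ioo 0 u) (fun t =>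
          D * (ENNReal.ofReal (b t) * F.tildeNormOn (Ioo t u) fun s => powerWeight θ a s * k s) +
          c * (C₁ * powerWeight θ a u) * ENNReal.ofReal (b t)) := by
          refine E.tildeNormOn_mono 0 (fun _ h _ _ => h) fun t _ ht _ => ?_
          have h4 : F.tildeNormOn (Ioi t) (fun s => powerWeight θ a s * k₀ s) ≤
              D * F.tildeNormOn (Ioo t u) (fun s => powerWeight θ a s * k s) +
                c * (C₁ * powerWeight θ a u) := by
            refine (F.tildeNormOn_le_add u measurableSet_Ioo measurableSet_Ioi
              (S := Ioo t u) (T := Ioi u) (aemeasurable_powerWeight_mul ha hk₀)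
              fun s hs _ hsu => ?_).trans (add_le_add ?_ (htail u hu))
            · exact (lt_or_gt_of_ne hsu).imp (fun h => ⟨hs, h⟩) id
            · rw [← F.tildeNormOn_const_mul _ measurableSet_Ioo (aemeasurable_powerWeight_mul ha hk)]
              refine F.tildeNormOn_mono 0 (fun _ h _ _ => h) fun s hsu hs _ => ?_
              calc _ ≤ powerWeight θ a s * (D * k s) := by gcongr; exact hD s hs hsu.2.le
                _ = _ := by ring
          calc _ ≤ ENNReal.ofReal (b t) *
                (D * F.tildeNormOn (Ioo t u) (fun s => powerWeight θ a s * k s) +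
                  c * (C₁ * powerWeight θ a u)) := by gcongr
            _ = _ := by ring
      _ ≤ _ := by
          refine (E.tildeNormOn_add_le measurableSet_Ioo (hm.const_mul _)
            (hb.aemeasurable_ofReal.const_mul _)).trans (le_of_eq ?_)
          rw [E.tildeNormOn_const_mul _ measurableSet_Ioo hm,
            E.tildeNormOn_const_mul _ measurableSet_Ioo hb.aemeasurable_ofReal]
          rfl
  have houter : nestedNorm θ b E a F (Ioi u) Ioi k₀ ≤
      c * C₁ * (C₂ * (C₃ * headNorm E b u * powerWeight θ a u)) := by
    calc _ ≤ E.tildeNormOn (Ioi u) (fun t => c * C₁ * (ENNReal.ofReal (b t) * powerWeight θ a t)) := by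
          refine E.tildeNormOn_mono 0 (fun _ h _ _ => h) fun t _ ht _ => ?_
          calc _ ≤ ENNReal.ofReal (b t) * (c * (C₁ * powerWeight θ a t)) := by
                gcongr; exact htail t ht
            _ = _ := by ring
      _ = c * C₁ * E.tildeNormOn (Ioi u) (fun t => ENNReal.ofReal (b t) * powerWeight θ a t) :=
          E.tildeNormOn_const_mul _ measurableSet_Ioi (hb.aemeasurable_ofReal.mul hWm)
      _ ≤ c * C₁ * (C₂ * (ENNReal.ofReal (b u) * powerWeight θ a u)) := by gcongr; exact h₂ u hu
      _ ≤ _ := by gcongr; exact h₃ u hu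
  calc _ ≤ nestedNorm θ b E a F (Ioo 0 u) Ioi k₀ + nestedNorm θ b E a F (Ioi u) Ioi k₀ :=
        E.tildeNormOn_le_add u measurableSet_Ioo measurableSet_Ioi
          (aemeasurable_nested hb F antitone_Ioi_real _)
          fun t _ ht htu => (lt_or_gt_of_ne htu).imp (fun h => ⟨ht, h⟩) id
    _ ≤ _ := add_le_add hinner houter
    _ = _ := by push_cast; ring

/-- Meant for `k₁ = K(·, f₁)`. Below `u` the linear bound is used: `s` times the weight grows like a
power because `θ < 1`, so the contribution of (0, u) is of the size of the weight times `k` at `u`,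
and the tail norm dominates that. Beyond `u` the comparison with `k` suffices. -/
theorem exists_nestedNorm_le_of_le_linear (hθ : θ < 1) (ha : SlowlyVarying a)
    (hb : SlowlyVarying b) (E F : RISpace) :
    ∃ C : ℝ≥0, ∀ (D : ℝ≥0) (d : ℝ≥0∞) (k k₁ : ℝ → ℝ≥0∞), Monotone k → Monotone k₁ → ∀ u, 0 < u →
      (∀ s, 0 < s → k₁ s ≤ ENNReal.ofReal s * d) → ENNReal.ofReal u * d ≤ 2 * k u →
      (∀ s, u ≤ s → k₁ s ≤ D * k s) →
      nestedNorm θ b E a F univ Ioi k₁ ≤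
        (C + D) * (headNorm E b u * F.tildeNormOn (Ioi u) (fun s => powerWeight θ a s * k s)) +
          D * nestedNorm θ b E a F (Ioi u) Ioi k := by
  have hε : 0 < (1 - θ) / 2 := by linarith
  have hW := (lowerPower_rpow 1).mul
    (powerWeight_lowerPower (θ := θ) ha (show -θ - (1 - θ) / 2 < -θ by linarith))
  rw [show 1 + (-θ - (1 - θ) / 2) = (1 - θ) / 2 by ring] at hW
  simp only [Real.rpow_one] at hW
  obtain ⟨C₁, h₁⟩ := F.tildeNormOn_Ioo_le_of_lowerPower hε hW
  obtain ⟨C₂, _, h₂⟩ := exists_mul_le_tail ha θ F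
  refine ⟨2 * C₁ * C₂, fun D d k k₁ hk hk₁ u hu hd hdu hD => ?_⟩
  have hWm := powerWeight_aemeasurable (θ := θ) ha
  set τ := F.tildeNormOn (Ioi u) (fun s => powerWeight θ a s * k s) with hτ
  have hhead : F.tildeNormOn (Ioo 0 u) (fun s => powerWeight θ a s * k₁ s) ≤ 2 * C₁ * C₂ * τ := by
    calc _ ≤ F.tildeNormOn (Ioo 0 u) (fun s => d * (ENNReal.ofReal s * powerWeight θ a s)) := by
          refine F.tildeNormOn_mono 0 (fun _ h _ _ => h) fun s _ hs _ => ?_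
          calc _ ≤ powerWeight θ a s * (ENNReal.ofReal s * d) := by gcongr; exact hd s hs
            _ = _ := by ring
      _ = d * F.tildeNormOn (Ioo 0 u) (fun s => ENNReal.ofReal s * powerWeight θ a s) :=
          F.tildeNormOn_const_mul _ measurableSet_Ioo
            (ENNReal.measurable_ofReal.aemeasurable.mul hWm)
      _ ≤ d * (C₁ * (ENNReal.ofReal u * powerWeight θ a u)) := by gcongr; exact h₁ u hu
      _ = C₁ * powerWeight θ a u * (ENNReal.ofReal u * d) := by ring
      _ ≤ C₁ * powerWeight θ a u * (2 * k u) := by gcongr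
      _ = 2 * C₁ * (powerWeight θ a u * k u) := by ring
      _ ≤ 2 * C₁ * (C₂ * τ) := mul_le_mul_right (h₂ k hk u hu) _
      _ = _ := by ring
  have htail : ∀ t, u ≤ t → F.tildeNormOn (Ioi t) (fun s => powerWeight θ a s * k₁ s) ≤
      D * F.tildeNormOn (Ioi t) (fun s => powerWeight θ a s * k s) := by
    intro t hut
    rw [← F.tildeNormOn_const_mul _ measurableSet_Ioi (aemeasurable_powerWeight_mul ha hk)]
    refine F.tildeNormOn_mono 0 (fun _ h _ _ => h) fun s hts hs _ => ?_
    calc _ ≤ powerWeight θ a s * (D * k s) := by gcongr; exact hD s (hut.trans (le_of_lt hts))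
      _ = _ := by ring
  have hinner : nestedNorm θ b E a F (Ioo 0 u) Ioi k₁ ≤
      (2 * C₁ * C₂ * τ + D * τ) * headNorm E b u := by
    rw [headNorm, ← E.tildeNormOn_const_mul _ measurableSet_Ioo hb.aemeasurable_ofReal]
    refine E.tildeNormOn_mono 0 (fun _ h _ _ => h) fun t _ ht _ => ?_
    rw [mul_comm]
    gcongr
    refine (F.tildeNormOn_le_add u measurableSet_Ioo measurableSet_Ioi
      (S := Ioo 0 u) (T := Ioi u) (aemeasurable_powerWeight_mul ha hk₁)
      fun s hs hs' hsu => ?_).trans (add_le_add hhead (htail u le_rfl))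
    exact (lt_or_gt_of_ne hsu).imp (fun h => ⟨hs', h⟩) id
  have houter : nestedNorm θ b E a F (Ioi u) Ioi k₁ ≤ D * nestedNorm θ b E a F (Ioi u) Ioi k := by
    rw [nestedNorm, nestedNorm, ← E.tildeNormOn_const_mul _ measurableSet_Ioi
      (aemeasurable_nested hb F antitone_Ioi_real _)]
    refine E.tildeNormOn_mono 0 (fun _ h _ _ => h) fun t hut ht _ => ?_
    calc _ ≤ ENNReal.ofReal (b t) *
          (D * F.tildeNormOn (Ioi t) (fun s => powerWeight θ a s * k s)) := by
          gcongr; exact htail t (le_of_lt hut)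
      _ = _ := by ring
  calc _ ≤ nestedNorm θ b E a F (Ioo 0 u) Ioi k₁ + nestedNorm θ b E a F (Ioi u) Ioi k₁ :=
        E.tildeNormOn_le_add u measurableSet_Ioo measurableSet_Ioi
          (aemeasurable_nested hb F antitone_Ioi_real _)
          fun t _ ht htu => (lt_or_gt_of_ne htu).imp (fun h => ⟨ht, h⟩) id
    _ ≤ _ := add_le_add hinner houter
    _ = _ := by push_cast; ring

end UpperEstimate

/-! ### Elementary properties of the K-functional. -/

section PeetreK

variable {A : Type*} [AddCommGroup A] {N₀ N₁ : A → ℝ≥0∞}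

theorem peetreK_le (t : ℝ≥0∞) {f f₀ f₁ : A} (h : f = f₀ + f₁) :
    peetreK N₀ N₁ t f ≤ N₀ f₀ + t * N₁ f₁ :=
  iInf_le_of_le f₀ (iInf_le_of_le f₁ (iInf_le_of_le h le_rfl))

theorem le_peetreK {t x : ℝ≥0∞} {f : A}
    (h : ∀ f₀ f₁, f = f₀ + f₁ → x ≤ N₀ f₀ + t * N₁ f₁) : x ≤ peetreK N₀ N₁ t f :=
  le_iInf fun f₀ => le_iInf fun f₁ => le_iInf fun hf => h f₀ f₁ hf

theorem exists_lt_of_peetreK_lt {t x : ℝ≥0∞} {f : A} (h : peetreK N₀ N₁ t f < x) :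
    ∃ f₀ f₁, f = f₀ + f₁ ∧ N₀ f₀ + t * N₁ f₁ < x := by
  simpa only [peetreK, iInf_lt_iff, exists_prop] using h

theorem le_mul_peetreK {c : ℝ≥0∞} (hc : c ≠ 0) (hc' : c ≠ ∞) {t x : ℝ≥0∞} {f : A}
    (h : ∀ f₀ f₁, f = f₀ + f₁ → x ≤ c * (N₀ f₀ + t * N₁ f₁)) : x ≤ c * peetreK N₀ N₁ t f := by
  have : x / c ≤ peetreK N₀ N₁ t f := le_peetreK fun f₀ f₁ hf =>
    ENNReal.div_le_of_le_mul' (h f₀ f₁ hf)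
  exact (ENNReal.div_le_iff' hc hc').1 this

theorem peetreK_mono (N₀ N₁ : A → ℝ≥0∞) (f : A) :
    Monotone fun s : ℝ => peetreK N₀ N₁ (ENNReal.ofReal s) f := fun s t hst =>
  le_peetreK fun f₀ f₁ hf => (peetreK_le _ hf).trans (by gcongr)

/-- The monotonicity of `K(s, f) / s`, written without division. -/
theorem mul_peetreK_le {s u : ℝ} (hs : 0 < s) (hsu : s ≤ u) (f : A) :
    ENNReal.ofReal s * peetreK N₀ N₁ (ENNReal.ofReal u) f ≤
      ENNReal.ofReal u * peetreK N₀ N₁ (ENNReal.ofReal s) f := by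
  refine le_mul_peetreK (by simpa using hs.trans_le hsu) ENNReal.ofReal_ne_top fun f₀ f₁ hf => ?_
  calc _ ≤ ENNReal.ofReal s * (N₀ f₀ + ENNReal.ofReal u * N₁ f₁) := by gcongr; exact peetreK_le _ hf
    _ = ENNReal.ofReal s * N₀ f₀ + ENNReal.ofReal u * (ENNReal.ofReal s * N₁ f₁) := by ring
    _ ≤ ENNReal.ofReal u * N₀ f₀ + ENNReal.ofReal u * (ENNReal.ofReal s * N₁ f₁) := by gcongr
    _ = _ := by ring

theorem peetreK_lt_top_of_mem_sumSpace {t : ℝ≥0∞} (ht : t ≠ ∞) {f : A} (hf : f ∈ sumSpace N₀ N₁) :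
    peetreK N₀ N₁ t f < ∞ := by
  obtain ⟨f₀, f₁, h, h₀, h₁⟩ := hf
  exact (peetreK_le t h).trans_lt
    (ENNReal.add_lt_top.2 ⟨h₀, ENNReal.mul_lt_top (lt_top_iff_ne_top.2 ht) h₁⟩)

end PeetreK

/-! ### Compatible couples of quasi-Banach spaces. -/

namespace EmbeddedQuasiBanach

variable {𝕜 A : Type*} [RCLike 𝕜] [AddCommGroup A] [Module 𝕜 A] [TopologicalSpace A]

theorem norm_zero (X : EmbeddedQuasiBanach 𝕜 A) : X.norm 0 = 0 := (X.norm_eq_zero_iff 0).2 rfl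

theorem norm_neg (X : EmbeddedQuasiBanach 𝕜 A) (x : A) : X.norm (-x) = X.norm x := by
  simpa using X.norm_smul (-1) x

variable (X₀ X₁ : EmbeddedQuasiBanach 𝕜 A)

theorem exists_norm_add_le :
    ∃ κ : ℝ≥0, 1 ≤ κ ∧ (∀ x y, X₀.norm (x + y) ≤ κ * (X₀.norm x + X₀.norm y)) ∧
      ∀ x y, X₁.norm (x + y) ≤ κ * (X₁.norm x + X₁.norm y) := by
  obtain ⟨κ₀, h₀⟩ := X₀.norm_add_le
  obtain ⟨κ₁, h₁⟩ := X₁.norm_add_le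
  refine ⟨1 + κ₀ + κ₁, by rw [add_assoc]; exact le_self_add, fun x y => (h₀ x y).trans ?_,
    fun x y => (h₁ x y).trans ?_⟩
  · gcongr; rw [add_right_comm]; exact le_add_self
  · gcongr; exact le_add_self

theorem peetreK_le_norm_left (t : ℝ≥0∞) (f : A) : peetreK X₀.norm X₁.norm t f ≤ X₀.norm f := by
  simpa [X₁.norm_zero] using
    peetreK_le (N₀ := X₀.norm) (N₁ := X₁.norm) t (show f = f + 0 by simp)

theorem peetreK_le_norm_right (t : ℝ≥0∞) (f : A) :
    peetreK X₀.norm X₁.norm t f ≤ t * X₁.norm f := by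
  simpa [X₀.norm_zero] using
    peetreK_le (N₀ := X₀.norm) (N₁ := X₁.norm) t (show f = 0 + f by simp)

theorem exists_peetreK_add_le :
    ∃ κ : ℝ≥0, 1 ≤ κ ∧ ∀ (t : ℝ≥0∞) (f g : A), peetreK X₀.norm X₁.norm t (f + g) ≤
      κ * (peetreK X₀.norm X₁.norm t f + peetreK X₀.norm X₁.norm t g) := by
  obtain ⟨κ, hκ, h₀, h₁⟩ := exists_norm_add_le X₀ X₁
  have hκ0 : (κ : ℝ≥0∞) ≠ 0 := by simpa using (one_pos.trans_le hκ).ne'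
  refine ⟨κ, hκ, fun t f g => ?_⟩
  simp only [peetreK, ENNReal.iInf_add, ENNReal.add_iInf, ENNReal.mul_iInf_of_ne hκ0
    ENNReal.coe_ne_top]
  refine le_iInf fun f₀ => le_iInf fun f₁ => le_iInf fun hf => le_iInf fun g₀ => le_iInf fun g₁ =>
    le_iInf fun hg => ?_
  refine (peetreK_le t (show f + g = (f₀ + g₀) + (f₁ + g₁) by rw [hf, hg]; abel)).trans ?_
  calc _ ≤ κ * (X₀.norm f₀ + X₀.norm g₀) + t * (κ * (X₁.norm f₁ + X₁.norm g₁)) := by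
        gcongr
        · exact h₀ _ _
        · exact h₁ _ _
    _ = _ := by ring

/-- If `K(u, f) = 0`, then `f` is a sum of two elements small in X_0 and X_1, hence close to 0 in
the ambient space. The Hausdorff property excludes this for `f ≠ 0`. -/
theorem eq_zero_of_peetreK_eq_zero [IsTopologicalAddGroup A] [T2Space A] {u : ℝ} (hu : 0 < u)
    {f : A} (h : peetreK X₀.norm X₁.norm (ENNReal.ofReal u) f = 0) : f = 0 := by
  by_contra hf
  have hadd : Tendsto (fun p : A × A => p.1 + p.2) (𝓝 0 ×ˢ 𝓝 0) (𝓝 0) := by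
    have := (continuous_add (M := A)).tendsto (0, 0)
    rwa [nhds_prod_eq, add_zero] at this
  obtain ⟨U, hU, hUf⟩ := mem_prod_same_iff.1
    (hadd (isOpen_compl_singleton.mem_nhds (show (0 : A) ∈ ({f} : Set A)ᶜ from fun h => hf h.symm)))
  obtain ⟨ε₀, hε₀, hX₀⟩ := X₀.continuous_embedding U hU
  obtain ⟨ε₁, hε₁, hX₁⟩ := X₁.continuous_embedding U hU
  have hu' : ENNReal.ofReal u ≠ 0 := by simpa using hu
  obtain ⟨f₀, f₁, hff, hlt⟩ := exists_lt_of_peetreK_lt (x := min ε₀ (ENNReal.ofReal u * ε₁))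
    (h ▸ lt_min hε₀ (ENNReal.mul_pos hu' hε₁.ne'))
  have h0 : X₀.norm f₀ < ε₀ := (le_self_add.trans_lt hlt).trans_le (min_le_left _ _)
  have h1 : ENNReal.ofReal u * X₁.norm f₁ < ENNReal.ofReal u * ε₁ :=
    (le_add_self.trans_lt hlt).trans_le (min_le_right _ _)
  have h2 : (f₀, f₁) ∈ U ×ˢ U := ⟨hX₀ _ h0, hX₁ _ (lt_of_mul_lt_mul_left' h1)⟩
  exact hUf h2 hff.symm

theorem exists_almost_optimal_decomposition [IsTopologicalAddGroup A] [T2Space A] {u : ℝ}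
    (hu : 0 < u) {f : A} (hf : f ∈ sumSpace X₀.norm X₁.norm) :
    ∃ f₀ f₁, f = f₀ + f₁ ∧ X₀.norm f₀ + ENNReal.ofReal u * X₁.norm f₁ ≤
      2 * peetreK X₀.norm X₁.norm (ENNReal.ofReal u) f := by
  -- When K vanishes there is no room between K and 2K for an almost optimal choice, so this case
  -- needs `f = 0`.
  by_cases h : peetreK X₀.norm X₁.norm (ENNReal.ofReal u) f = 0
  · refine ⟨0, 0, ?_, by simp [X₀.norm_zero, X₁.norm_zero]⟩
    rw [eq_zero_of_peetreK_eq_zero X₀ X₁ hu h, add_zero]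
  · have hlt := peetreK_lt_top_of_mem_sumSpace (ENNReal.ofReal_ne_top (r := u)) hf
    obtain ⟨f₀, f₁, hff, hl⟩ := exists_lt_of_peetreK_lt (N₀ := X₀.norm) (N₁ := X₁.norm) (f := f)
      (t := ENNReal.ofReal u) (x := 2 * peetreK X₀.norm X₁.norm (ENNReal.ofReal u) f)
      (by rw [two_mul]; exact ENNReal.lt_add_right hlt.ne h)
    exact ⟨f₀, f₁, hff, hl.le⟩

end EmbeddedQuasiBanach

/-! ### The two halves of the equivalence, for abstract monotone functions. -/

section Holmstedt

variable {θ₀ θ₁ : ℝ} {a₀ a₁ b₀ b₁ : ℝ → ℝ} {E₀ E₁ F₀ F₁ : RISpace}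

/-- The three-term expression that describes the `K`-functional of the couple of limiting spaces,
for a function `k` in the place of `K(·, f)`. -/
def holmstedtSum (θ₀ θ₁ : ℝ) (a₀ a₁ b₀ b₁ : ℝ → ℝ) (E₀ E₁ F₀ F₁ : RISpace) (k : ℝ → ℝ≥0∞)
    (u : ℝ) : ℝ≥0∞ :=
  nestedNorm θ₀ b₀ E₀ a₀ F₀ (Ioo 0 u) (fun t => Ioo t u) k
    + rhoRR θ₀ θ₁ a₀ a₁ b₀ b₁ E₀ E₁ u * (headNorm E₁ b₁ u *
        F₁.tildeNormOn (Ioi u) (fun s => powerWeight θ₁ a₁ s * k s))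
    + rhoRR θ₀ θ₁ a₀ a₁ b₀ b₁ E₀ E₁ u * nestedNorm θ₁ b₁ E₁ a₁ F₁ (Ioi u) Ioi k

theorem exists_holmstedtSum_le (hθ : θ₀ < θ₁) (ha₀ : SlowlyVarying a₀) (ha₁ : SlowlyVarying a₁)
    (hb₀ : SlowlyVarying b₀) (hb₁ : SlowlyVarying b₁)
    (hE₀ : headNorm E₀ b₀ 1 < ∞) (hE₁ : headNorm E₁ b₁ 1 < ∞) (F₀ F₁ : RISpace) :
    ∃ C : ℝ≥0, ∀ (κ : ℝ≥0∞) (k k₀ k₁ : ℝ → ℝ≥0∞), Monotone k₀ → Monotone k₁ →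
      (∀ s, 0 < s → k s ≤ κ * (k₀ s + k₁ s)) → ∀ u, 0 < u →
      holmstedtSum θ₀ θ₁ a₀ a₁ b₀ b₁ E₀ E₁ F₀ F₁ k u ≤
        κ * (C * (nestedNorm θ₀ b₀ E₀ a₀ F₀ univ Ioi k₀ +
          rhoRR θ₀ θ₁ a₀ a₁ b₀ b₁ E₀ E₁ u * nestedNorm θ₁ b₁ E₁ a₁ F₁ univ Ioi k₁)) := by
  obtain ⟨C₁, h₁⟩ := exists_inner_term_le hθ ha₀ ha₁ hb₀ hb₁ hE₁ E₀ F₀ F₁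
  obtain ⟨C₂, h₂⟩ := exists_middle_term_le hθ ha₀ ha₁ hb₀ hb₁ hE₀ hE₁ F₀ F₁
  obtain ⟨C₃, h₃⟩ := exists_outer_term_le hθ ha₀ ha₁ hb₀ hb₁ hE₀ hE₁ F₀ F₁
  refine ⟨3 + C₁ + C₂ + C₃, fun κ k k₀ k₁ hk₀ hk₁ h u hu => ?_⟩
  specialize h₁ k₁ hk₁ u hu
  specialize h₂ k₀ hk₀ u hu
  specialize h₃ k₀ hk₀ u hu
  set ρ := rhoRR θ₀ θ₁ a₀ a₁ b₀ b₁ E₀ E₁ u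
  set H := headNorm E₁ b₁ u
  have hin : nestedNorm θ₀ b₀ E₀ a₀ F₀ (Ioo 0 u) (fun t => Ioo t u) k₀ ≤
      nestedNorm θ₀ b₀ E₀ a₀ F₀ univ Ioi k₀ :=
    nestedNorm_mono (subset_univ _) fun _ _ => Ioo_subset_Ioi_self
  have hout : nestedNorm θ₁ b₁ E₁ a₁ F₁ (Ioi u) Ioi k₁ ≤ nestedNorm θ₁ b₁ E₁ a₁ F₁ univ Ioi k₁ :=
    nestedNorm_mono (subset_univ _) fun _ _ => subset_rfl
  have hmid := headNorm_mul_tail_le (E := E₁) (F := F₁) (θ := θ₁) (a := a₁) (k := k₁) hb₁ u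
  have g₁ := nestedNorm_le_of_le_mul_add (θ := θ₀) (E := E₀) (F := F₀) ha₀ hb₀
    (measurableSet_Ioo (a := 0) (b := u)) (fun _ => measurableSet_Ioo) (antitone_Ioo_real u) hk₀ hk₁ h
  have g₂ := tildeNormOn_le_of_le_mul_add (θ := θ₁) ha₁ F₁ (measurableSet_Ioi (a := u)) hk₀ hk₁ h
  have g₃ := nestedNorm_le_of_le_mul_add (θ := θ₁) (E := E₁) (F := F₁) ha₁ hb₁
    (measurableSet_Ioi (a := u)) (fun _ => measurableSet_Ioi) antitone_Ioi_real hk₀ hk₁ h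
  set N₀ := nestedNorm θ₀ b₀ E₀ a₀ F₀ univ Ioi k₀
  set N₁ := nestedNorm θ₁ b₁ E₁ a₁ F₁ univ Ioi k₁
  set τ₀ := F₁.tildeNormOn (Ioi u) fun s => powerWeight θ₁ a₁ s * k₀ s
  set τ₁ := F₁.tildeNormOn (Ioi u) fun s => powerWeight θ₁ a₁ s * k₁ s
  set O₀ := nestedNorm θ₁ b₁ E₁ a₁ F₁ (Ioi u) Ioi k₀
  set O₁ := nestedNorm θ₁ b₁ E₁ a₁ F₁ (Ioi u) Ioi k₁
  set I₀ := nestedNorm θ₀ b₀ E₀ a₀ F₀ (Ioo 0 u) (fun t => Ioo t u) k₀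
  set I₁ := nestedNorm θ₀ b₀ E₀ a₀ F₀ (Ioo 0 u) (fun t => Ioo t u) k₁
  calc _ ≤ κ * (I₀ + I₁) + ρ * (H * (κ * (τ₀ + τ₁))) + ρ * (κ * (O₀ + O₁)) :=
        add_le_add (add_le_add g₁ (by gcongr)) (by gcongr)
    _ = κ * ((I₀ + I₁) + (ρ * (H * τ₀) + ρ * (H * τ₁)) + (ρ * O₀ + ρ * O₁)) := by ring
    _ ≤ κ * ((N₀ + C₁ * (ρ * N₁)) + (C₂ * N₀ + ρ * N₁) + (C₃ * N₀ + ρ * N₁)) := by gcongr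
    _ = κ * ((1 + C₂ + C₃) * N₀ + (2 + C₁) * (ρ * N₁)) := by ring
    _ ≤ κ * ((3 + C₁ + C₂ + C₃) * N₀ + (3 + C₁ + C₂ + C₃) * (ρ * N₁)) := by
        have e₀ : (1 + C₂ + C₃ : ℝ≥0∞) ≤ 3 + C₁ + C₂ + C₃ :=
          calc (1 + C₂ + C₃ : ℝ≥0∞) ≤ 1 + C₂ + C₃ + (2 + C₁) := le_self_add
            _ = _ := by ring
        have e₁ : (2 + C₁ : ℝ≥0∞) ≤ 3 + C₁ + C₂ + C₃ :=
          calc (2 + C₁ : ℝ≥0∞) ≤ 2 + C₁ + (1 + C₂ + C₃) := le_self_add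
            _ = _ := by ring
        exact mul_le_mul_right (add_le_add (mul_le_mul_left e₀ _) (mul_le_mul_left e₁ _)) _
    _ = _ := by push_cast; ring

theorem exists_add_le_holmstedtSum (hθ₀ : 0 < θ₀) (hθ₁ : θ₁ < 1)
    (ha₀ : SlowlyVarying a₀) (ha₁ : SlowlyVarying a₁)
    (hb₀ : SlowlyVarying b₀) (hb₁ : SlowlyVarying b₁)
    (hE₁ : headNorm E₁ b₁ 1 < ∞) (E₀ F₀ F₁ : RISpace) (D : ℝ≥0) :
    ∃ C : ℝ≥0, ∀ (d : ℝ≥0∞) (k k₀ k₁ : ℝ → ℝ≥0∞), Monotone k → Monotone k₀ → Monotone k₁ →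
      ∀ u, 0 < u →
      (∀ s, 0 < s → k₀ s ≤ 2 * k u) → (∀ s, 0 < s → s ≤ u → k₀ s ≤ D * k s) →
      (∀ s, 0 < s → k₁ s ≤ ENNReal.ofReal s * d) → ENNReal.ofReal u * d ≤ 2 * k u →
      (∀ s, u ≤ s → k₁ s ≤ D * k s) →
      nestedNorm θ₀ b₀ E₀ a₀ F₀ univ Ioi k₀ +
          rhoRR θ₀ θ₁ a₀ a₁ b₀ b₁ E₀ E₁ u * nestedNorm θ₁ b₁ E₁ a₁ F₁ univ Ioi k₁ ≤
        C * holmstedtSum θ₀ θ₁ a₀ a₁ b₀ b₁ E₀ E₁ F₀ F₁ k u := by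
  obtain ⟨C₀, h₀⟩ := exists_nestedNorm_le_of_le_const hθ₀ ha₀ hb₀ E₀ F₀
  obtain ⟨C₁, h₁⟩ := exists_nestedNorm_le_of_le_linear hθ₁ ha₁ hb₁ E₁ F₁
  obtain ⟨C₂, _, h₂⟩ := exists_mul_le_tail ha₁ θ₁ F₁
  refine ⟨D + 2 * C₀ * C₂ + C₁, fun d k k₀ k₁ hk hk₀ hk₁ u hu hk₀u hk₀k hk₁d hdu hk₁k => ?_⟩
  specialize h₀ D _ k k₀ hk hk₀ u hu hk₀u hk₀k
  specialize h₁ D d k k₁ hk hk₁ u hu hk₁d hdu hk₁k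
  specialize h₂ k hk u hu
  -- The remainder from `k₀` carries the weight of Y_0 at `u`; rewritten as ρ times the weight of
  -- Y_1, it is absorbed into the middle term through `h₂`.
  rw [← rhoRR_mul (θ₀ := θ₀) (a₀ := a₀) (b₀ := b₀) (E₀ := E₀) (θ₁ := θ₁) ha₁ hb₁ hE₁ hu] at h₀
  rw [holmstedtSum]
  set ρ := rhoRR θ₀ θ₁ a₀ a₁ b₀ b₁ E₀ E₁ u
  set H := headNorm E₁ b₁ u
  set τ := F₁.tildeNormOn (Ioi u) fun s => powerWeight θ₁ a₁ s * k s
  set O := nestedNorm θ₁ b₁ E₁ a₁ F₁ (Ioi u) Ioi k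
  set I := nestedNorm θ₀ b₀ E₀ a₀ F₀ (Ioo 0 u) (fun t => Ioo t u) k
  calc _ ≤ (D * I + C₀ * (ρ * (powerWeight θ₁ a₁ u * H) * (2 * k u))) +
        ρ * ((C₁ + D) * (H * τ) + D * O) := by gcongr
    _ = D * I + 2 * C₀ * (ρ * H) * (powerWeight θ₁ a₁ u * k u) +
        ρ * ((C₁ + D) * (H * τ) + D * O) := by ring
    _ ≤ D * I + 2 * C₀ * (ρ * H) * (C₂ * τ) + ρ * ((C₁ + D) * (H * τ) + D * O) := by gcongr
    _ = D * I + (D + 2 * C₀ * C₂ + C₁) * (ρ * (H * τ)) + D * (ρ * O) := by ring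
    _ ≤ (D + 2 * C₀ * C₂ + C₁) * I + (D + 2 * C₀ * C₂ + C₁) * (ρ * (H * τ)) +
        (D + 2 * C₀ * C₂ + C₁) * (ρ * O) := by
        have : (D : ℝ≥0∞) ≤ D + 2 * C₀ * C₂ + C₁ := by rw [add_assoc]; exact le_self_add
        gcongr
    _ = _ := by push_cast; ring

end Holmstedt

/-! ### The quasi-norm of the limiting spaces as an iterated norm. -/

section LimitingSpace

variable {A : Type*} [AddCommGroup A] {N₀ N₁ : A → ℝ≥0∞}

theorem rNorm_eq_nestedNorm {θ : ℝ} {b a : ℝ → ℝ} {E F : RISpace} {f : A}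
    (hf : f ∈ sumSpace N₀ N₁) :
    rNorm N₀ N₁ θ b E a F f =
      nestedNorm θ b E a F univ Ioi fun s => peetreK N₀ N₁ (ENNReal.ofReal s) f := by
  rw [rNorm, if_pos hf, nestedNorm, RISpace.tildeNormOn_univ]
  rfl

theorem nestedNorm_le_rNorm (N₀ N₁ : A → ℝ≥0∞) (θ : ℝ) (b : ℝ → ℝ) (E : RISpace) (a : ℝ → ℝ)
    (F : RISpace) (f : A) :
    (nestedNorm θ b E a F univ Ioi fun s => peetreK N₀ N₁ (ENNReal.ofReal s) f) ≤
      rNorm N₀ N₁ θ b E a F f := by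
  by_cases hf : f ∈ sumSpace N₀ N₁
  · exact (rNorm_eq_nestedNorm hf).ge
  · rw [rNorm, if_neg hf]
    exact le_top

theorem mem_sumSpace_of_rNorm_lt_top {θ : ℝ} {b a : ℝ → ℝ} {E F : RISpace} {f : A}
    (hf : rNorm N₀ N₁ θ b E a F f < ∞) : f ∈ sumSpace N₀ N₁ := by
  by_contra h
  rw [rNorm, if_neg h] at hf
  exact lt_irrefl _ hf

end LimitingSpace

/-! ### The almost optimal decomposition. -/

namespace EmbeddedQuasiBanach

variable {𝕜 A : Type*} [RCLike 𝕜] [AddCommGroup A] [Module 𝕜 A] [TopologicalSpace A]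
  (X₀ X₁ : EmbeddedQuasiBanach 𝕜 A)

theorem add_mem_sumSpace {f g : A} (hf : f ∈ sumSpace X₀.norm X₁.norm)
    (hg : g ∈ sumSpace X₀.norm X₁.norm) : f + g ∈ sumSpace X₀.norm X₁.norm := by
  obtain ⟨κ, _, h₀, h₁⟩ := exists_norm_add_le X₀ X₁
  obtain ⟨f₀, f₁, rfl, hf₀, hf₁⟩ := hf
  obtain ⟨g₀, g₁, rfl, hg₀, hg₁⟩ := hg
  refine ⟨f₀ + g₀, f₁ + g₁, by abel, (h₀ _ _).trans_lt ?_, (h₁ _ _).trans_lt ?_⟩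
  · exact ENNReal.mul_lt_top ENNReal.coe_lt_top (ENNReal.add_lt_top.2 ⟨hf₀, hg₀⟩)
  · exact ENNReal.mul_lt_top ENNReal.coe_lt_top (ENNReal.add_lt_top.2 ⟨hf₁, hg₁⟩)

/-- The `K`-functionals of the two parts of an almost optimal decomposition of `f` at `u`, in terms
of the `K`-functional of `f`. -/
theorem exists_decomposition_peetreK [IsTopologicalAddGroup A] [T2Space A] :
    ∃ D : ℝ≥0, ∀ f ∈ sumSpace X₀.norm X₁.norm, ∀ u, 0 < u →
      ∃ (f₀ f₁ : A) (d : ℝ≥0∞), f = f₀ + f₁ ∧ f₀ ∈ sumSpace X₀.norm X₁.norm ∧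
        f₁ ∈ sumSpace X₀.norm X₁.norm ∧
        (∀ s, 0 < s → peetreK X₀.norm X₁.norm (ENNReal.ofReal s) f₀ ≤
          2 * peetreK X₀.norm X₁.norm (ENNReal.ofReal u) f) ∧
        (∀ s, 0 < s → s ≤ u → peetreK X₀.norm X₁.norm (ENNReal.ofReal s) f₀ ≤
          D * peetreK X₀.norm X₁.norm (ENNReal.ofReal s) f) ∧
        (∀ s, 0 < s → peetreK X₀.norm X₁.norm (ENNReal.ofReal s) f₁ ≤ ENNReal.ofReal s * d) ∧
        ENNReal.ofReal u * d ≤ 2 * peetreK X₀.norm X₁.norm (ENNReal.ofReal u) f ∧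
        ∀ s, u ≤ s → peetreK X₀.norm X₁.norm (ENNReal.ofReal s) f₁ ≤
          D * peetreK X₀.norm X₁.norm (ENNReal.ofReal s) f := by
  obtain ⟨κ, _, hκ⟩ := exists_peetreK_add_le X₀ X₁
  -- Each part is `f` minus the other part, and the other part contributes at most `2 K(s, f)` on
  -- the relevant side of `u`; hence 1 + 2 under the quasi-triangle constant `κ`.
  refine ⟨κ * 3, fun f hf u hu => ?_⟩
  obtain ⟨f₀, f₁, hff, hle⟩ := exists_almost_optimal_decomposition X₀ X₁ hu hf
  have hu0 : ENNReal.ofReal u ≠ 0 := by simpa using hu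
  have hK := peetreK_lt_top_of_mem_sumSpace (ENNReal.ofReal_ne_top (r := u)) hf
  have hle₀ := le_self_add.trans hle
  have hle₁ := le_add_self.trans hle
  have hfin : 2 * peetreK X₀.norm X₁.norm (ENNReal.ofReal u) f < ∞ :=
    ENNReal.mul_lt_top ENNReal.ofNat_lt_top hK
  have hf₁ : X₁.norm f₁ < ∞ := by
    by_contra! h
    rw [top_le_iff.1 h, ENNReal.mul_top hu0] at hle₁
    exact absurd hfin (not_lt.2 hle₁)
  have hz₀ : X₀.norm 0 < ∞ := by simp [X₀.norm_zero]
  have hz₁ : X₁.norm 0 < ∞ := by simp [X₁.norm_zero]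
  refine ⟨f₀, f₁, X₁.norm f₁, hff, ⟨f₀, 0, by simp, hle₀.trans_lt hfin, hz₁⟩,
    ⟨0, f₁, by simp, hz₀, hf₁⟩, fun s _ => (peetreK_le_norm_left X₀ X₁ _ _).trans hle₀,
    fun s hs hsu => ?_, fun s _ => peetreK_le_norm_right X₀ X₁ _ _, hle₁, fun s hus => ?_⟩
  · have h1 : ENNReal.ofReal s * X₁.norm f₁ ≤
        2 * peetreK X₀.norm X₁.norm (ENNReal.ofReal s) f := by
      rw [← ENNReal.mul_le_mul_iff_right hu0 ENNReal.ofReal_ne_top]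
      calc _ = ENNReal.ofReal s * (ENNReal.ofReal u * X₁.norm f₁) := by ring
        _ ≤ ENNReal.ofReal s * (2 * peetreK X₀.norm X₁.norm (ENNReal.ofReal u) f) := by gcongr
        _ = 2 * (ENNReal.ofReal s * peetreK X₀.norm X₁.norm (ENNReal.ofReal u) f) := by ring
        _ ≤ 2 * (ENNReal.ofReal u * peetreK X₀.norm X₁.norm (ENNReal.ofReal s) f) :=
            mul_le_mul_right (mul_peetreK_le hs hsu f) _
        _ = _ := by ring
    calc _ ≤ κ * (peetreK X₀.norm X₁.norm (ENNReal.ofReal s) f +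
          peetreK X₀.norm X₁.norm (ENNReal.ofReal s) (-f₁)) := by
          rw [show f₀ = f + -f₁ by rw [hff]; abel]; exact hκ _ _ _
      _ ≤ κ * (peetreK X₀.norm X₁.norm (ENNReal.ofReal s) f +
          2 * peetreK X₀.norm X₁.norm (ENNReal.ofReal s) f) := by
          gcongr
          refine (peetreK_le_norm_right X₀ X₁ _ _).trans ?_
          rwa [X₁.norm_neg]
      _ = _ := by push_cast; ring
  · calc _ ≤ κ * (peetreK X₀.norm X₁.norm (ENNReal.ofReal s) f +
          peetreK X₀.norm X₁.norm (ENNReal.ofReal s) (-f₀)) := by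
          rw [show f₁ = f + -f₀ by rw [hff]; abel]; exact hκ _ _ _
      _ ≤ κ * (peetreK X₀.norm X₁.norm (ENNReal.ofReal s) f +
          2 * peetreK X₀.norm X₁.norm (ENNReal.ofReal s) f) := by
          gcongr
          refine (peetreK_le_norm_left X₀ X₁ _ _).trans ?_
          rw [X₀.norm_neg]
          exact hle₀.trans (mul_le_mul_right (peetreK_mono _ _ f hus) _)
      _ = _ := by push_cast; ring

end EmbeddedQuasiBanach

end

/-! ### The theorem. -/

theorem theorem3p1 {𝕜 A : Type*} [RCLike 𝕜] [AddCommGroup A] [Module 𝕜 A] [TopologicalSpace A]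
    [IsTopologicalAddGroup A] [ContinuousSMul 𝕜 A] [T2Space A]
    (X₀ X₁ : EmbeddedQuasiBanach 𝕜 A)
    (θ₀ θ₁ : ℝ) (hθ₀ : 0 < θ₀) (hθ : θ₀ < θ₁) (hθ₁ : θ₁ < 1)
    (E₀ E₁ F₀ F₁ : RISpace) (a₀ a₁ b₀ b₁ : ℝ → ℝ)
    (ha₀ : SlowlyVarying a₀) (ha₁ : SlowlyVarying a₁)
    (hb₀ : SlowlyVarying b₀) (hb₁ : SlowlyVarying b₁)
    (hE₀ : headNorm E₀ b₀ 1 < ∞) (hE₁ : headNorm E₁ b₁ 1 < ∞) :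
    ∃ C : ℝ≥0, 0 < C ∧
      ∀ f ∈ sumSpace (rNorm X₀.norm X₁.norm θ₀ b₀ E₀ a₀ F₀)
          (rNorm X₀.norm X₁.norm θ₁ b₁ E₁ a₁ F₁),
      ∀ u : ℝ, 0 < u →
        EquivWithConst C
          (peetreK (rNorm X₀.norm X₁.norm θ₀ b₀ E₀ a₀ F₀) (rNorm X₀.norm X₁.norm θ₁ b₁ E₁ a₁ F₁)
            (rhoRR θ₀ θ₁ a₀ a₁ b₀ b₁ E₀ E₁ u) f)
          (E₀.tildeNormOn (Ioo 0 u) (fun t => ENNReal.ofReal (b₀ t) *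
              F₀.tildeNormOn (Ioo t u) (weightedK X₀.norm X₁.norm θ₀ a₀ f))
            + rhoRR θ₀ θ₁ a₀ a₁ b₀ b₁ E₀ E₁ u * (headNorm E₁ b₁ u *
                F₁.tildeNormOn (Ioi u) (weightedK X₀.norm X₁.norm θ₁ a₁ f))
            + rhoRR θ₀ θ₁ a₀ a₁ b₀ b₁ E₀ E₁ u *
                E₁.tildeNormOn (Ioi u) (fun t => ENNReal.ofReal (b₁ t) *
                  F₁.tildeNormOn (Ioi t) (weightedK X₀.norm X₁.norm θ₁ a₁ f))) := by
  obtain ⟨κ, hκ, hK⟩ := EmbeddedQuasiBanach.exists_peetreK_add_le X₀ X₁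
  obtain ⟨C, hC⟩ := exists_holmstedtSum_le hθ ha₀ ha₁ hb₀ hb₁ hE₀ hE₁ F₀ F₁
  obtain ⟨D, hD⟩ := EmbeddedQuasiBanach.exists_decomposition_peetreK X₀ X₁
  obtain ⟨C', hC'⟩ := exists_add_le_holmstedtSum hθ₀ hθ₁ ha₀ ha₁ hb₀ hb₁ hE₁ E₀ F₀ F₁ D
  -- The two directions give `C'` and `κ * C`; the summand 1 keeps the constant nonzero, which
  -- moving it past the infimum also requires.
  refine ⟨1 + C' + κ * C, by positivity, fun f hf u hu => ?_⟩
  have hmono := peetreK_mono X₀.norm X₁.norm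
  change EquivWithConst _ _ (holmstedtSum θ₀ θ₁ a₀ a₁ b₀ b₁ E₀ E₁ F₀ F₁
    (fun s => peetreK X₀.norm X₁.norm (ENNReal.ofReal s) f) u)
  constructor
  · have hfX : f ∈ sumSpace X₀.norm X₁.norm := by
      obtain ⟨g, h, rfl, hg, hh⟩ := hf
      exact EmbeddedQuasiBanach.add_mem_sumSpace X₀ X₁ (mem_sumSpace_of_rNorm_lt_top hg)
        (mem_sumSpace_of_rNorm_lt_top hh)
    obtain ⟨f₀, f₁, d, hff, hf₀, hf₁, h1, h2, h3, h4, h5⟩ := hD f hfX u hu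
    refine (peetreK_le _ hff).trans ?_
    rw [rNorm_eq_nestedNorm hf₀, rNorm_eq_nestedNorm hf₁]
    refine (hC' d _ _ _ (hmono f) (hmono f₀) (hmono f₁) u hu h1 h2 h3 h4 h5).trans ?_
    gcongr
    rw [add_right_comm]
    exact le_add_self
  · refine le_mul_peetreK (by simp) (by finiteness) fun g h hgh => ?_
    refine (hC κ _ _ _ (hmono g) (hmono h) (fun s _ => hgh ▸ hK _ g h) u hu).trans ?_
    rw [← mul_assoc, ← ENNReal.coe_mul]
    gcongr
    · exact le_add_self
    -- An arbitrary decomposition may leave X_0 + X_1; there the quasi-norm is `∞` and the bound is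
    -- trivial.
    · exact nestedNorm_le_rNorm _ _ _ _ _ _ _ _
    · exact nestedNorm_le_rNorm _ _ _ _ _ _ _ _
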